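/- **Model.** An LAQCC circuit (Local Alternating Quantum-Classical Computation) is a family of circuits, one for each $n$, acting on qubits placed on a two-dimensional grid, that consists of $O(1)$ rounds. In each round (i) a classical circuit over AND, OR, NOT gates of bounded fan-in, of depth $O(\log n)$ and size polynomial in $n$, is evaluated on the outcomes of the measurements of earlier rounds; (ii) a quantum circuit of depth $O(1)$ and size polynomial in $n$ is applied, whose gates are arbitrary single-qubit gates and CNOT gates between neighbouring qubits of the grid, and each of whose gates may be controlled by an output bit of the classical circuit; (iii) a subset of the qubits is measured in the computational basis. The circuit is required to prepare a pure state deterministically from the all-zeroes state, that is, the final state is (up to a global phase) the same for all measurement outcomes of non-zero probability. **Theorem.** For $n \ge 1$ let $$|W_n\rangle = \frac{1}{\sqrt n}\sum_{i=0}^{n-1} |e_i\rangle ,$$ where $e_i\in\{0,1\}^n$ has a one in position $i$ and zeroes elsewhere. There is an LAQCC circuit that for every $n\ge 1$ prepares $|W_n\rangle$ on $n$ of its qubits, with all its other qubits ending in the state $|0\rangle$. This circuit uses $O(n\log n)$ qubits, placed on a grid with $n$ rows and $O(\log n)$ columns. -/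

import Mathlib

open Filter Asymptotics

namespace LAQCC

/-! ## Classical layers: Boolean circuits of bounded fan-in -/

/-- One output of a classical circuit of fan-in at most two over AND, OR, NOT, whose input wires
are labelled by `α`, written out as a tree. -/
inductive Formula (α : Type) : Type
  | const : Bool → Formula α
  | var : α → Formula α
  | not : Formula α → Formula α
  | and : Formula α → Formula α → Formula α
  | or : Formula α → Formula α → Formula α

namespace Formula

variable {α : Type}

/-- Value of the output on the input assignment `m`. -/
def eval (m : α → Bool) : Formula α → Bool
  | const b => b
  | var a => m a
  | not f => !(f.eval m)
  | and f g => f.eval m && g.eval m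
  | or f g => f.eval m || g.eval m

/-- Length of the longest path from an input to the output. -/
def depth : Formula α → ℕ
  | const _ => 0
  | var _ => 0
  | not f => f.depth + 1
  | and f g => max f.depth g.depth + 1
  | or f g => max f.depth g.depth + 1

/-- Number of nodes. -/
def size : Formula α → ℕ
  | const _ => 1
  | var _ => 1
  | not f => f.size + 1
  | and f g => f.size + g.size + 1
  | or f g => f.size + g.size + 1

/-- The input wires that are read. -/
def vars : Formula α → Set α
  | const _ => ∅
  | var a => {a}
  | not f => f.vars
  | and f g => f.vars ∪ g.vars
  | or f g => f.vars ∪ g.vars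

end Formula

/-! ## Pure states of a finite set of qubits -/

/-- Amplitudes with respect to the computational basis of the qubits `Q`. -/
abbrev State (Q : Type) : Type := (Q → Bool) → ℂ

section States

variable {Q : Type} [Fintype Q] [DecidableEq Q]

/-- The computational basis state `|y⟩`. -/
def ket (y : Q → Bool) : State Q := fun x => if x = y then 1 else 0

/-- The all-zeroes state. -/
def zeroState : State Q := ket fun _ => false

/-- Unit vectors. -/
def IsNormalized (ψ : State Q) : Prop := ∑ x, ‖ψ x‖ ^ 2 = 1

/-- The bit string `e_i` with a one at position `i` and zeroes elsewhere. -/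
def oneHot {n : ℕ} (i : Fin n) : Fin n → Bool := fun j => decide (j = i)

/-- `|W_n⟩ = n^{-1/2} ∑_i |e_i⟩`. -/
noncomputable def wState (n : ℕ) : State (Fin n) :=
  fun x => (1 / (Real.sqrt n : ℂ)) * ∑ i : Fin n, ket (oneHot i) x

open Classical in
/-- The state of the qubits `Q` that is `φ` on the output register `out` and `|0⟩` on every other
qubit. -/
noncomputable def withZeroAncillas {n : ℕ} (out : Fin n ↪ Q) (φ : State (Fin n)) : State Q :=
  fun x => if ∀ q, q ∉ Set.range out → x q = false then φ (fun i => x (out i)) else 0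

end States

/-! ## Quantum layers -/

/-- The gate set: all single-qubit gates and the CNOT gate (control first, target second). -/
inductive Gate (Q : Type) : Type
  | single : Q → Matrix.unitaryGroup Bool ℂ → Gate Q
  | cnot : Q → Q → Gate Q

section Quantum

variable {Q : Type} [DecidableEq Q]

/-- The qubits on which a gate acts. -/
def Gate.support : Gate Q → Finset Q
  | .single q _ => {q}
  | .cnot c t => {c, t}

/-- The action of a gate on states. -/
noncomputable def Gate.apply : Gate Q → State Q → State Q
  | .single q U, ψ => fun x => ∑ b : Bool, (U : Matrix Bool Bool ℂ) (x q) b * ψ (Function.update x q b)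
  | .cnot c t, ψ => fun x => ψ (Function.update x t (xor (x t) (x c)))

/-- A gate that is applied unconditionally (`control = none`), or only if the given one of the
`w` output bits of the classical circuit is `1`. -/
structure ControlledGate (Q : Type) (w : ℕ) : Type where
  control : Option (Fin w)
  gate : Gate Q

/-- The action of a controlled gate when the classical circuit has output `y`. -/
noncomputable def ControlledGate.apply {w : ℕ} (y : Fin w → Bool) (g : ControlledGate Q w)
    (ψ : State Q) : State Q :=
  match g.control with
  | none => g.gate.apply ψ
  | some i => if y i then g.gate.apply ψ else ψ

/-- One classical circuit `C`, followed by one quantum circuit `U(y)` controlled by the output `y`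
of `C`, followed by a measurement of a subset of the qubits in the computational basis.

The input wire `(s, q)` of the classical circuit is the outcome of measuring qubit `q` in round `s`.
The quantum circuit is a list of time steps, each of which is a list of simultaneous gates. -/
structure Round (Q : Type) : Type where
  width : ℕ
  classical : Fin width → Formula (ℕ × Q)
  quantum : List (List (ControlledGate Q width))
  measured : Finset Q

/-- Projection onto the outcomes `b` of the measurement of the qubits in `M`. -/
def project (M : Finset Q) (b : Q → Bool) (ψ : State Q) : State Q :=
  fun x => if ∀ q ∈ M, x q = b q then ψ x else 0

/-- The quantum circuit of a round, with the classical control bits `y`. -/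
noncomputable def Round.applyQuantum (R : Round Q) (y : Fin R.width → Bool) (ψ : State Q) :
    State Q :=
  R.quantum.foldl (fun ψ step => step.foldl (fun ψ g => g.apply y ψ) ψ) ψ

/-- Alternating classical and quantum circuits, in order of execution. -/
abbrev Circuit (Q : Type) : Type := List (Round Q)

/-- The unnormalised state after executing the rounds, the first of which has number `t`, on the
branch where the measurement of qubit `q` in round `s` has outcome `m (s, q)`. Its squared norm is
the probability of the branch. -/
noncomputable def runFrom (m : ℕ × Q → Bool) : ℕ → Circuit Q → State Q → State Q
  | _, [], ψ => ψ
  | t, R :: C, ψ =>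
      runFrom m (t + 1) C
        (project R.measured (fun q => m (t, q))
          (R.applyQuantum (fun i => (R.classical i).eval m) ψ))

/-- The circuit deterministically prepares the pure state `φ` from the all-zeroes state: `φ` is a
unit vector and, up to a scalar, it is the final state for all measurement outcomes (the scalar
is zero exactly for the outcomes that have probability zero). -/
def Prepares [Fintype Q] (C : Circuit Q) (φ : State Q) : Prop :=
  IsNormalized φ ∧ ∀ m : ℕ × Q → Bool, ∃ c : ℂ, runFrom m 0 C zeroState = c • φ

/-- In each time step the gates act on pairwise disjoint sets of qubits. -/
def Circuit.Parallel (C : Circuit Q) : Prop :=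
  ∀ R ∈ C, ∀ step ∈ R.quantum,
    step.Pairwise fun g h => Disjoint g.gate.support h.gate.support

/-- Each classical circuit reads only the outcomes of measurements made in earlier rounds. -/
def Circuit.Causal (C : Circuit Q) : Prop :=
  ∀ t : Fin C.length, ∀ i, ∀ v ∈ ((C.get t).classical i).vars,
    ∃ s : Fin C.length, s < t ∧ v.1 = s ∧ v.2 ∈ (C.get s).measured

/-- All CNOT gates act on pairs of qubits related by `adj`. -/
def Circuit.Local (adj : Q → Q → Prop) (C : Circuit Q) : Prop :=
  ∀ R ∈ C, ∀ step ∈ R.quantum, ∀ g ∈ step, ∀ c t : Q, g.gate = .cnot c t → adj c t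

/-- The total number of quantum gates. -/
def Circuit.quantumSize (C : Circuit Q) : ℕ :=
  (C.map fun R => (R.quantum.map List.length).sum).sum

/-- The total size of the classical circuits. -/
def Circuit.classicalSize (C : Circuit Q) : ℕ :=
  (C.map fun R => ∑ i, (R.classical i).size).sum

/-- The classical circuits all have depth at most `D`. -/
def Circuit.ClassicalDepthLE (C : Circuit Q) (D : ℕ) : Prop :=
  ∀ R ∈ C, ∀ i, (R.classical i).depth ≤ D

/-- The quantum circuits all have depth at most `D`. -/
def Circuit.QuantumDepthLE (C : Circuit Q) (D : ℕ) : Prop :=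
  ∀ R ∈ C, R.quantum.length ≤ D

end Quantum

/-! ## The grid and the class LAQCC -/

/-- Qubits on a grid with `r` rows and `c` columns. -/
abbrev Grid (r c : ℕ) : Type := Fin r × Fin c

/-- Direct neighbours on the grid. -/
def Grid.Adj {r c : ℕ} (p q : Grid r c) : Prop :=
  (p.1 = q.1 ∧ ((p.2 : ℕ) + 1 = q.2 ∨ (q.2 : ℕ) + 1 = p.2)) ∨
    (p.2 = q.2 ∧ ((p.1 : ℕ) + 1 = q.1 ∨ (q.1 : ℕ) + 1 = p.1))

/-- The family `C n`, on grids with `rows n` rows and `cols n` columns, is an LAQCC circuit: a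
constant number of alternations of nearest-neighbour quantum circuits of constant depth and
polynomial size (`QNC⁰`) with classical circuits of logarithmic depth, polynomial size and bounded
fan-in (`NC¹`), which deterministically prepares a pure state. -/
structure IsLAQCC {rows cols : ℕ → ℕ} (C : ∀ n, Circuit (Grid (rows n) (cols n))) : Prop where
  parallel : ∀ n, (C n).Parallel
  causal : ∀ n, (C n).Causal
  nearestNeighbour : ∀ n, (C n).Local Grid.Adj
  rounds : ∃ d : ℕ, ∀ n, (C n).length ≤ d
  quantumDepth : ∃ d : ℕ, ∀ n, (C n).QuantumDepthLE d
  quantumSize : ∃ k : ℕ,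
    (fun n => ((C n).quantumSize : ℝ)) =O[atTop] fun n : ℕ => (n : ℝ) ^ k
  classicalDepth : ∃ D : ℕ → ℕ, (∀ n, (C n).ClassicalDepthLE (D n)) ∧
    (fun n => (D n : ℝ)) =O[atTop] fun n : ℕ => Real.log n
  classicalSize : ∃ k : ℕ,
    (fun n => ((C n).classicalSize : ℝ)) =O[atTop] fun n : ℕ => (n : ℝ) ^ k
  deterministic : ∀ n, ∃ φ, Prepares (C n) φ

end LAQCC

/-! The state is produced by one exact step of amplitude amplification. Rotating each of `n` zero
qubits by an angle `β` gives the weight-one strings total probability `n (sin β cos^(n-1) β)^2`. By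
`exists_rotation` this can be made equal to `1/4`, so the amplitude is `sin (π/6)`, and a single
Grover iteration turns it into `sin (π/2) = 1` (`amplify`). What remains is to implement exactly, in
a constant number of rounds, the signs `weightSign c` for `c = 0, 1`.

To test whether the Hamming weight is `c`, take a column register of `k`, about `log n`, qubits.
Qubit `t` collects by phase kickback the phase `π (weight - c) / 2^t`, and a Hadamard gate follows.
If the weight is `c`, every qubit returns to `|0⟩`. Otherwise `weight - c` is `2^t` times an odd
number for some `t < k`, and qubit `t` is exactly in `|1⟩`. Reflecting about the zero state of the
column register therefore gives the exact sign (`zeroSign_mul_regState`), after which the register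
is uncomputed.

The reflection itself is a product of parity phases (`prod_parPhase`): a nonzero `v` has odd inner
product with exactly half of the `2^k` strings `S`, so the phase `π / 2^(k-1)` for each odd parity
gives `-1` in total. The rows of the grid evaluate these parities in parallel, in two passes since
`2^k ≤ 2n`.

Both the kickback and the parities reduce to the bipartite phase `couple`, which couples every row
qubit to every column qubit. Row bits are fanned out along rows and column bits along columns, so
that copies of each pair become close on the grid. Fan-out and its inverse take constant quantum
depth thanks to measurements, with Pauli corrections given by parities of outcomes
(`implements_fan`, `implements_fan_inverse`).

The bookkeeping notion is `Implements`: the scalar it allows depends on the outcomes but not on the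
input state, so everything may be checked on basis states and extended linearly. -/

set_option linter.unusedSectionVars false

namespace LAQCC

/-! ## Linearity of the execution of a circuit -/

section Linearity

variable {Q : Type} [DecidableEq Q]

theorem Gate.isLinearMap_apply (g : Gate Q) : IsLinearMap ℂ (g.apply) := by
  cases g with
  | single q U =>
    constructor
    · intro ψ φ
      funext x
      simp only [Gate.apply, Pi.add_apply, mul_add, Finset.sum_add_distrib]
    · intro c ψ
      funext x
      simp only [Gate.apply, Pi.smul_apply, smul_eq_mul, Finset.mul_sum]
      exact Finset.sum_congr rfl fun b _ => by ring
  | cnot c t => constructor <;> intros <;> rfl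

theorem ControlledGate.isLinearMap_apply {w : ℕ} (y : Fin w → Bool) (g : ControlledGate Q w) :
    IsLinearMap ℂ (g.apply y) := by
  rcases g with ⟨_ | i, g⟩
  · exact g.isLinearMap_apply
  · by_cases h : y i = true
    · have : ControlledGate.apply y ⟨some i, g⟩ = g.apply := by
        funext ψ
        simp [ControlledGate.apply, h]
      rw [this]
      exact g.isLinearMap_apply
    · have : ControlledGate.apply y ⟨some i, g⟩ = id := by
        funext ψ
        simp [ControlledGate.apply, h]
      rw [this]
      exact ⟨fun _ _ => rfl, fun _ _ => rfl⟩

theorem isLinearMap_foldl {α : Type} (F : α → State Q → State Q) (l : List α)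
    (hF : ∀ a, IsLinearMap ℂ (F a)) :
    IsLinearMap ℂ fun ψ => l.foldl (fun ψ a => F a ψ) ψ := by
  induction l with
  | nil => exact ⟨fun _ _ => rfl, fun _ _ => rfl⟩
  | cons a l ih =>
    constructor
    · intro ψ φ
      simp only [List.foldl_cons, (hF a).map_add]
      exact ih.map_add _ _
    · intro c ψ
      simp only [List.foldl_cons, (hF a).map_smul]
      exact ih.map_smul _ _

theorem Round.isLinearMap_applyQuantum (R : Round Q) (y : Fin R.width → Bool) :
    IsLinearMap ℂ (R.applyQuantum y) :=
  isLinearMap_foldl (fun (step : List (ControlledGate Q R.width)) ψ =>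
    step.foldl (fun ψ g => g.apply y ψ) ψ) _ fun step =>
      isLinearMap_foldl (fun (g : ControlledGate Q R.width) ψ => g.apply y ψ) step
        fun g => g.isLinearMap_apply y

theorem isLinearMap_project (M : Finset Q) (b : Q → Bool) : IsLinearMap ℂ (project M b) := by
  constructor
  · intro ψ φ
    funext x
    simp only [project, Pi.add_apply]
    split_ifs <;> simp
  · intro c ψ
    funext x
    simp only [project, Pi.smul_apply]
    split_ifs <;> simp

theorem isLinearMap_runFrom (m : ℕ × Q → Bool) (t : ℕ) (C : Circuit Q) :
    IsLinearMap ℂ (runFrom m t C) := by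
  induction C generalizing t with
  | nil => exact ⟨fun _ _ => rfl, fun _ _ => rfl⟩
  | cons R C ih =>
    constructor
    · intro ψ φ
      simp only [runFrom, (R.isLinearMap_applyQuantum _).map_add,
        (isLinearMap_project _ _).map_add, (ih _).map_add]
    · intro c ψ
      simp only [runFrom, (R.isLinearMap_applyQuantum _).map_smul,
        (isLinearMap_project _ _).map_smul, (ih _).map_smul]

theorem runFrom_append (m : ℕ × Q → Bool) (t : ℕ) (C₁ C₂ : Circuit Q) (ψ : State Q) :
    runFrom m t (C₁ ++ C₂) ψ = runFrom m (t + C₁.length) C₂ (runFrom m t C₁ ψ) := by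
  induction C₁ generalizing t ψ with
  | nil => rfl
  | cons R C ih =>
    simp only [List.cons_append, runFrom, ih, List.length_cons]
    congr 1
    omega

end Linearity

/-! ## Product states and layers of single-qubit gates -/

section Product

variable {Q : Type} [Fintype Q] [DecidableEq Q]

/-- The product state with one-qubit factors `τ`. -/
def productState (τ : Q → Bool → ℂ) : State Q := fun x => ∏ q, τ q (x q)

/-- The basis state `|b⟩` of one qubit. -/
def bit (b : Bool) : Bool → ℂ := fun a => if a = b then 1 else 0

/-- A matrix acting on a one-qubit state. -/
def act (V : Matrix Bool Bool ℂ) (τ : Bool → ℂ) : Bool → ℂ := fun a => ∑ b, V a b * τ b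

/-- The tensor product of the one-qubit operators `V q`. -/
def tensor (V : Q → Matrix Bool Bool ℂ) (ψ : State Q) : State Q :=
  fun x => ∑ y, (∏ q, V q (x q) (y q)) * ψ y

theorem ket_eq_productState (y : Q → Bool) : ket y = productState fun q => bit (y q) := by
  funext x
  simp only [ket, productState, bit, Finset.prod_ite_zero, Finset.mem_univ, true_imp_iff,
    Finset.prod_const_one, funext_iff]

theorem state_eq_sum_ket (ψ : State Q) : ψ = ∑ y, ψ y • ket y := by
  funext x
  simp [ket, Finset.sum_apply]

theorem isLinearMap_ext {f g : State Q → State Q} (hf : IsLinearMap ℂ f) (hg : IsLinearMap ℂ g)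
    (h : ∀ y, f (ket y) = g (ket y)) : f = g := by
  funext ψ
  have key : ∀ {f : State Q → State Q}, IsLinearMap ℂ f → f ψ = ∑ y, ψ y • f (ket y) := by
    intro f hf
    conv_lhs => rw [state_eq_sum_ket ψ]
    rw [← hf.mk'_apply, map_sum]
    simp
  rw [key hf, key hg]
  simp [h]

theorem isLinearMap_tensor (V : Q → Matrix Bool Bool ℂ) : IsLinearMap ℂ (tensor V) := by
  constructor
  · intro ψ φ
    funext x
    simp only [tensor, Pi.add_apply, mul_add, Finset.sum_add_distrib]
  · intro c ψ
    funext x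
    simp only [tensor, Pi.smul_apply, smul_eq_mul, Finset.mul_sum]
    exact Finset.sum_congr rfl fun b _ => by ring

theorem tensor_productState (V : Q → Matrix Bool Bool ℂ) (τ : Q → Bool → ℂ) :
    tensor V (productState τ) = productState fun q => act (V q) (τ q) := by
  funext x
  simp only [tensor, productState, act, ← Finset.prod_mul_distrib]
  rw [Finset.prod_univ_sum, Fintype.piFinset_univ]

theorem act_bit (V : Matrix Bool Bool ℂ) (b a : Bool) : act V (bit b) a = V a b := by
  simp [act, bit]

@[simp] theorem act_one (τ : Bool → ℂ) : act 1 τ = τ := by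
  funext a
  simp [act, Matrix.one_apply]

theorem act_mul (V W : Matrix Bool Bool ℂ) (τ : Bool → ℂ) : act (V * W) τ = act V (act W τ) := by
  funext a
  simp only [act, Matrix.mul_apply, Fintype.sum_bool]
  ring

/-- Each row of `V q` has at most one nonzero entry, so the sum over bit strings collapses to one
term. This covers all Pauli corrections and all phase gates. -/
theorem tensor_monomial (V : Q → Matrix Bool Bool ℂ) (s : Q → Bool) (d : Q → Bool → ℂ)
    (hV : ∀ q a b, V q a b = if b = xor a (s q) then d q a else 0) (ψ : State Q) (x : Q → Bool) :
    tensor V ψ x = (∏ q, d q (x q)) * ψ fun q => xor (x q) (s q) := by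
  have h : ∀ y : Q → Bool, (∀ q, y q = xor (x q) (s q)) ↔ y = fun q => xor (x q) (s q) :=
    fun y => funext_iff.symm
  simp only [tensor, hV, Finset.prod_ite_zero, Finset.mem_univ, true_imp_iff, h]
  simp

theorem apply_single_productState (q : Q) (U : Matrix.unitaryGroup Bool ℂ) (τ : Q → Bool → ℂ) :
    (Gate.single q U).apply (productState τ) =
      productState (Function.update τ q (act U (τ q))) := by
  funext x
  simp only [Gate.apply, productState]
  rw [← Finset.mul_prod_erase _ _ (Finset.mem_univ q)]
  simp only [Function.update_self, act, Finset.sum_mul]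
  refine Finset.sum_congr rfl fun b _ => ?_
  rw [← Finset.mul_prod_erase _ _ (Finset.mem_univ q), mul_assoc, Function.update_self]
  congr 2
  refine Finset.prod_congr rfl fun p hp => ?_
  rw [Function.update_of_ne (Finset.ne_of_mem_erase hp),
    Function.update_of_ne (Finset.ne_of_mem_erase hp)]

/-- The round that applies `U q` to each qubit `q` for which the formula `F q` is true. -/
noncomputable def layer (U : Q → Matrix.unitaryGroup Bool ℂ) (F : Q → Formula (ℕ × Q)) : Round Q where
  width := Fintype.card Q
  classical i := F ((Fintype.equivFin Q).symm i)
  quantum := [Finset.univ.toList.map fun q => ⟨some (Fintype.equivFin Q q), .single q (U q)⟩]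
  measured := ∅

/-- The round that applies a CNOT gate with target `q` and control `src q`, for each `q`. -/
noncomputable def cnots (src : Q → Option Q) : Round Q where
  width := 0
  classical i := i.elim0
  quantum := [Finset.univ.toList.filterMap fun q => (src q).map fun c => ⟨none, .cnot c q⟩]
  measured := ∅

/-- The round that only measures the qubits in `M`. -/
def measure (M : Finset Q) : Round Q where
  width := 0
  classical i := i.elim0
  quantum := []
  measured := M

theorem project_empty (b : Q → Bool) (ψ : State Q) : project ∅ b ψ = ψ := by
  funext x
  simp [project]

theorem runFrom_measure (m : ℕ × Q → Bool) (t : ℕ) (M : Finset Q) (ψ : State Q) :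
    runFrom m t [measure M] ψ = project M (fun q => m (t, q)) ψ := rfl

/-- By linearity it suffices to treat basis states. These are product states, on which each gate of
the layer changes only its own factor. -/
theorem runFrom_layer (m : ℕ × Q → Bool) (t : ℕ) (U : Q → Matrix.unitaryGroup Bool ℂ)
    (F : Q → Formula (ℕ × Q)) (ψ : State Q) :
    runFrom m t [layer U F] ψ =
      tensor (fun q => if (F q).eval m then (U q : Matrix Bool Bool ℂ) else 1) ψ := by
  refine congrFun (isLinearMap_ext (isLinearMap_runFrom m t _) (isLinearMap_tensor _) ?_) ψ
  intro y
  rw [ket_eq_productState, tensor_productState]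
  simp only [runFrom, layer, project_empty, Round.applyQuantum, List.foldl_cons, List.foldl_nil]
  have key : ∀ (l : List Q), l.Nodup → ∀ τ : Q → Bool → ℂ,
      (l.map fun q => (⟨some (Fintype.equivFin Q q), .single q (U q)⟩ :
        ControlledGate Q (Fintype.card Q))).foldl (fun ψ g => g.apply
          (fun i => (F ((Fintype.equivFin Q).symm i)).eval m) ψ) (productState τ) =
      productState fun q => if q ∈ l then
        act (if (F q).eval m then (U q : Matrix Bool Bool ℂ) else 1) (τ q) else τ q := by
    intro l
    induction l with
    | nil => intro _ τ; simp
    | cons p l ih =>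
      intro hl τ
      have hstep : ControlledGate.apply (fun i => (F ((Fintype.equivFin Q).symm i)).eval m)
          (⟨some (Fintype.equivFin Q p), .single p (U p)⟩ : ControlledGate Q (Fintype.card Q))
          (productState τ) = productState (Function.update τ p
            (act (if (F p).eval m then (U p : Matrix Bool Bool ℂ) else 1) (τ p))) := by
        simp only [ControlledGate.apply, Equiv.symm_apply_apply]
        split_ifs
        · exact apply_single_productState _ _ _
        · simp
      rw [List.map_cons, List.foldl_cons, hstep, ih (List.nodup_cons.1 hl).2]
      congr 1
      funext q
      by_cases hq : q = p
      · subst hq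
        simp [(List.nodup_cons.1 hl).1]
      · simp [hq]
  rw [key _ (Finset.nodup_toList _)]
  simp

/-- The action of a layer of CNOT gates on bit strings. -/
def flipBy (src : Q → Option Q) (x : Q → Bool) : Q → Bool :=
  fun q => match src q with
    | none => x q
    | some c => xor (x q) (x c)

/-- The CNOT gates of a layer act on pairwise disjoint pairs of qubits. -/
structure IsMatching (src : Q → Option Q) : Prop where
  src_src : ∀ q c, src q = some c → src c = none
  inj : ∀ q q' c, src q = some c → src q' = some c → q = q'

/-- A control is never a target of the layer, so no gate alters a bit that another gate reads, and
the sequential composition equals the simultaneous flip. -/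
theorem runFrom_cnots (m : ℕ × Q → Bool) (t : ℕ) (src : Q → Option Q) (h : IsMatching src)
    (ψ : State Q) : runFrom m t [cnots src] ψ = fun x => ψ (flipBy src x) := by
  simp only [runFrom, cnots, project_empty, Round.applyQuantum, List.foldl_cons, List.foldl_nil]
  have key : ∀ (l : List Q), l.Nodup → ∀ ψ : State Q,
      (l.filterMap fun q => (src q).map fun c => (⟨none, .cnot c q⟩ :
        ControlledGate Q 0)).foldl (fun ψ g => g.apply
          (fun i => ((i.elim0 : Formula (ℕ × Q))).eval m) ψ) ψ =
      fun x => ψ fun q => if q ∈ l then flipBy src x q else x q := by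
    intro l
    induction l with
    | nil => intro _ ψ; simp
    | cons p l ih =>
      intro hl ψ
      rw [List.filterMap_cons]
      cases hp : src p with
      | none =>
        simp only [Option.map_none, ih (List.nodup_cons.1 hl).2]
        funext x
        congr 1
        funext q
        by_cases hq : q = p
        · subst hq
          simp [flipBy, hp]
        · simp [hq]
      | some c =>
        simp only [Option.map_some, List.foldl_cons, ih (List.nodup_cons.1 hl).2]
        funext x
        simp only [ControlledGate.apply, Gate.apply]
        congr 1
        funext q
        have hc : src c = none := h.src_src p c hp
        by_cases hq : q = p
        · subst hq
          simp only [Function.update_self, List.mem_cons, true_or, if_true,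
            (List.nodup_cons.1 hl).1, if_false]
          simp [flipBy, hp, hc]
        · simp [hq]
  rw [key _ (Finset.nodup_toList _)]
  simp

end Product


/-! ## Parities of measurement outcomes -/

namespace Formula

variable {α : Type}

/-- Exclusive or. -/
def xor (f g : Formula α) : Formula α := or (and f (not g)) (and (not f) g)

/-- The parity of `2 ^ h` consecutive formulas, the first of which is `g a`. -/
def xorTree (g : ℕ → Formula α) : ℕ → ℕ → Formula α
  | 0, a => g a
  | h + 1, a => xor (xorTree g h a) (xorTree g h (a + 2 ^ h))

end Formula

/-- The parity of `g a, …, g (a + n - 1)`. -/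
def parity (g : ℕ → Bool) (a : ℕ) : ℕ → Bool
  | 0 => false
  | n + 1 => xor (parity g a n) (g (a + n))

theorem parity_add (g : ℕ → Bool) (a n p : ℕ) :
    parity g a (n + p) = xor (parity g a n) (parity g (a + n) p) := by
  induction p with
  | zero => simp [parity]
  | succ p ih => rw [← add_assoc, parity, parity, ih, Bool.xor_assoc, add_assoc]

theorem parity_congr {g g' : ℕ → Bool} {n : ℕ} (h : ∀ i < n, g i = g' i) :
    parity g 0 n = parity g' 0 n := by
  induction n with
  | zero => rfl
  | succ n ih =>
    rw [parity, parity, ih fun i hi => h i (by omega), zero_add, h n (by omega)]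

theorem parity_eq_of_le {g : ℕ → Bool} {n p : ℕ} (hnp : n ≤ p) (h : ∀ i, n ≤ i → g i = false) :
    parity g 0 p = parity g 0 n := by
  induction p, hnp using Nat.le_induction with
  | base => rfl
  | succ p hp ih => rw [parity, ih, zero_add, h p hp, Bool.xor_false]

namespace Formula

variable {α : Type}

theorem eval_xor (m : α → Bool) (f g : Formula α) :
    (f.xor g).eval m = Bool.xor (f.eval m) (g.eval m) := by
  simp only [xor, eval]
  cases f.eval m <;> cases g.eval m <;> rfl

theorem eval_xorTree (m : α → Bool) (g : ℕ → Formula α) (h a : ℕ) :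
    (xorTree g h a).eval m = parity (fun i => (g i).eval m) a (2 ^ h) := by
  induction h generalizing a with
  | zero => simp [xorTree, parity]
  | succ h ih => rw [xorTree, eval_xor, ih, ih, pow_succ, mul_two, parity_add]

/-- One exclusive or costs three levels: a negation, a conjunction and a disjunction. -/
theorem depth_xorTree (g : ℕ → Formula α) (hg : ∀ i, (g i).depth = 0) (h a : ℕ) :
    (xorTree g h a).depth ≤ 3 * h := by
  induction h generalizing a with
  | zero => simp [xorTree, hg]
  | succ h ih =>
    have h₁ := ih a
    have h₂ := ih (a + 2 ^ h)
    simp only [xorTree, xor, depth]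
    omega

theorem vars_xorTree (g : ℕ → Formula α) (S : Set α) (hg : ∀ i, (g i).vars ⊆ S) (h a : ℕ) :
    (xorTree g h a).vars ⊆ S := by
  induction h generalizing a with
  | zero => exact hg a
  | succ h ih =>
    simp only [xorTree, xor, vars, Set.union_subset_iff]
    exact ⟨⟨ih _, ih _⟩, ih _, ih _⟩

/-- The formula `xorTree` for the parity of the first `c` of the inputs `w 0, …, w (len - 1)`. -/
def prefixParity {len : ℕ} (w : Fin len → α) (h c : ℕ) : Formula α :=
  xorTree (fun i => if hi : i < len ∧ i < c then var (w ⟨i, hi.1⟩) else const false) h 0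

/-- The tree always has `2 ^ h` leaves. Those at position `c` or later are constantly false and do
not affect the parity. -/
theorem eval_prefixParity (m : α → Bool) {len : ℕ} (w : Fin len → α) (h c : ℕ) (hc : c ≤ len)
    (hh : len ≤ 2 ^ h) : (prefixParity w h c).eval m =
      parity (fun i => if hi : i < len then m (w ⟨i, hi⟩) else false) 0 c := by
  rw [prefixParity, eval_xorTree, parity_eq_of_le (n := c) (hc.trans hh)]
  · refine parity_congr fun i hi => ?_
    have : i < len := by omega
    simp [hi, this, eval]
  · intro i hi
    have : ¬ i < c := by omega
    simp [this, eval]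

theorem depth_prefixParity {len : ℕ} (w : Fin len → α) (h c : ℕ) :
    (prefixParity w h c).depth ≤ 3 * h :=
  depth_xorTree _ (fun i => by split_ifs <;> rfl) _ _

theorem vars_prefixParity {len : ℕ} (w : Fin len → α) (h c : ℕ) :
    (prefixParity w h c).vars ⊆ Set.range w :=
  vars_xorTree _ _ (fun i => by
    split_ifs
    · simp [vars]
    · simp [vars]) _ _

/-- Formulas are binary trees, so logarithmic depth already forces polynomial size. -/
theorem size_lt (f : Formula α) : f.size < 2 ^ (f.depth + 1) := by
  induction f with
  | const b => simp [size, depth]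
  | var a => simp [size, depth]
  | not f ih =>
    have : 1 ≤ 2 ^ (f.depth + 1) := Nat.one_le_two_pow
    simp only [size, depth]
    rw [pow_succ]
    omega
  | and f g ihf ihg =>
    have h₁ : 2 ^ (f.depth + 1) ≤ 2 ^ (max f.depth g.depth + 1) :=
      Nat.pow_le_pow_right (by norm_num) (by omega)
    have h₂ : 2 ^ (g.depth + 1) ≤ 2 ^ (max f.depth g.depth + 1) :=
      Nat.pow_le_pow_right (by norm_num) (by omega)
    simp only [size, depth]
    rw [pow_succ]
    omega
  | or f g ihf ihg =>
    have h₁ : 2 ^ (f.depth + 1) ≤ 2 ^ (max f.depth g.depth + 1) :=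
      Nat.pow_le_pow_right (by norm_num) (by omega)
    have h₂ : 2 ^ (g.depth + 1) ≤ 2 ^ (max f.depth g.depth + 1) :=
      Nat.pow_le_pow_right (by norm_num) (by omega)
    simp only [size, depth]
    rw [pow_succ]
    omega

end Formula

/-! ## Circuits that implement a map up to scalars -/

section Implements

variable {Q : Type} [Fintype Q] [DecidableEq Q]

/-- The rounds of `C`, the first of which has number `t`, fit the gate set, read only outcomes of
measurements made by `C`, have classical depth at most `D` and quantum depth at most one, and have
at most one gate and one classical output per qubit. -/
structure Circuit.WellFormed (adj : Q → Q → Prop) (D t : ℕ) (C : Circuit Q) : Prop where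
  parallel : C.Parallel
  causal : ∀ i R, C[i]? = some R → ∀ j, ∀ v ∈ (R.classical j).vars,
    ∃ s R', s < i ∧ C[s]? = some R' ∧ v.1 = t + s ∧ v.2 ∈ R'.measured
  nearest : C.Local adj
  classicalDepth : C.ClassicalDepthLE D
  quantumDepth : C.QuantumDepthLE 1
  width_le : ∀ R ∈ C, R.width ≤ Fintype.card Q
  gates_le : ∀ R ∈ C, (R.quantum.map List.length).sum ≤ Fintype.card Q

theorem Circuit.WellFormed.append {adj : Q → Q → Prop} {D t : ℕ} {C₁ C₂ : Circuit Q}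
    (h₁ : C₁.WellFormed adj D t) (h₂ : C₂.WellFormed adj D (t + C₁.length)) :
    Circuit.WellFormed adj D t (C₁ ++ C₂) where
  parallel R hR := (List.mem_append.1 hR).elim (h₁.parallel R) (h₂.parallel R)
  causal i R hR j v hv := by
    rw [List.getElem?_append] at hR
    split_ifs at hR with hi
    · obtain ⟨s, R', hs, hR', h⟩ := h₁.causal i R hR j v hv
      exact ⟨s, R', hs, by rw [List.getElem?_append_left (by omega), hR'], h⟩
    · obtain ⟨s, R', hs, hR', h, h'⟩ := h₂.causal _ R hR j v hv
      refine ⟨C₁.length + s, R', by omega, ?_, by omega, h'⟩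
      rw [List.getElem?_append_right (by omega), Nat.add_sub_cancel_left, hR']
  nearest R hR := (List.mem_append.1 hR).elim (h₁.nearest R) (h₂.nearest R)
  classicalDepth R hR := (List.mem_append.1 hR).elim (h₁.classicalDepth R) (h₂.classicalDepth R)
  quantumDepth R hR := (List.mem_append.1 hR).elim (h₁.quantumDepth R) (h₂.quantumDepth R)
  width_le R hR := (List.mem_append.1 hR).elim (h₁.width_le R) (h₂.width_le R)
  gates_le R hR := (List.mem_append.1 hR).elim (h₁.gates_le R) (h₂.gates_le R)

/-- Some circuit with at most `len` rounds maps each state `α i` to a multiple of `β i`, by a factor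
that depends only on the measurement outcomes. -/
def Implements (adj : Q → Q → Prop) (D len : ℕ) {ι : Type*} (α β : ι → State Q) : Prop :=
  ∀ t, ∃ C : Circuit Q, C.length ≤ len ∧ C.WellFormed adj D t ∧
    ∀ m, ∃ c : ℂ, ∀ i, runFrom m t C (α i) = c • β i

variable {adj : Q → Q → Prop} {D : ℕ}

namespace Implements

/-- Classical wires carry absolute round numbers. This is why `Implements` quantifies over the
starting round: the second circuit is taken at the round where the first one stops. -/
theorem trans {ι : Type*} {l₁ l₂ : ℕ} {α β γ : ι → State Q} (h₁ : Implements adj D l₁ α β)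
    (h₂ : Implements adj D l₂ β γ) : Implements adj D (l₁ + l₂) α γ := by
  intro t
  obtain ⟨C₁, hl₁, hw₁, hr₁⟩ := h₁ t
  obtain ⟨C₂, hl₂, hw₂, hr₂⟩ := h₂ (t + C₁.length)
  refine ⟨C₁ ++ C₂, by simp only [List.length_append]; omega, hw₁.append hw₂, fun m => ?_⟩
  obtain ⟨c₁, hc₁⟩ := hr₁ m
  obtain ⟨c₂, hc₂⟩ := hr₂ m
  refine ⟨c₁ * c₂, fun i => ?_⟩
  rw [runFrom_append, hc₁, (isLinearMap_runFrom _ _ _).map_smul, hc₂, smul_smul]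

theorem comp {ι κ : Type*} {l : ℕ} {α β : ι → State Q} (h : Implements adj D l α β) (f : κ → ι) :
    Implements adj D l (fun i => α (f i)) (fun i => β (f i)) := by
  intro t
  obtain ⟨C, hl, hw, hr⟩ := h t
  refine ⟨C, hl, hw, fun m => ?_⟩
  obtain ⟨c, hc⟩ := hr m
  exact ⟨c, fun i => hc _⟩

theorem of_eq_smul {ι : Type*} {l : ℕ} {α β γ : ι → State Q} (h : Implements adj D l α β) (c : ℂ)
    (hc : ∀ i, β i = c • γ i) : Implements adj D l α γ := by
  intro t
  obtain ⟨C, hl, hw, hr⟩ := h t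
  refine ⟨C, hl, hw, fun m => ?_⟩
  obtain ⟨c', hc'⟩ := hr m
  exact ⟨c' * c, fun i => by rw [hc', hc, smul_smul]⟩

theorem smul {ι : Type*} {l : ℕ} {α β : ι → State Q} (h : Implements adj D l α β) (a : ι → ℂ) :
    Implements adj D l (fun i => a i • α i) (fun i => a i • β i) := by
  intro t
  obtain ⟨C, hl, hw, hr⟩ := h t
  refine ⟨C, hl, hw, fun m => ?_⟩
  obtain ⟨c, hc⟩ := hr m
  exact ⟨c, fun i => by rw [(isLinearMap_runFrom _ _ _).map_smul, hc, smul_comm]⟩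

/-- On each measurement branch the factor `c` is common to all indices and can be pulled out of a
superposition. This is the reason for the order of quantifiers in `Implements`. -/
theorem sum {ι κ : Type*} [Fintype ι] {l : ℕ} {α β : ι → State Q} (h : Implements adj D l α β)
    (a : κ → ι → ℂ) :
    Implements adj D l (fun j => ∑ i, a j i • α i) (fun j => ∑ i, a j i • β i) := by
  intro t
  obtain ⟨C, hl, hw, hr⟩ := h t
  refine ⟨C, hl, hw, fun m => ?_⟩
  obtain ⟨c, hc⟩ := hr m
  refine ⟨c, fun j => ?_⟩
  rw [← (isLinearMap_runFrom m t C).mk'_apply, map_sum, Finset.smul_sum]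
  refine Finset.sum_congr rfl fun i _ => ?_
  rw [map_smul, IsLinearMap.mk'_apply, hc, smul_comm]

/-- A map that multiplies basis states by scalars does so with all their superpositions. -/
theorem diagonal {κ : Type*} {l : ℕ} {P : (Q → Bool) → Prop} {d : (Q → Bool) → ℂ}
    (h : Implements adj D l (fun y : {y // P y} => ket y.1) (fun y => d y.1 • ket y.1))
    (ψ : κ → State Q) (hψ : ∀ j x, ψ j x ≠ 0 → P x) :
    Implements adj D l ψ (fun j x => d x * ψ j x) := by
  classical
  -- Used with `e = 1` for the source and `e = d` for the target. Strings violating `P` may be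
  -- dropped because `ψ j` vanishes on them.
  have key : ∀ j (e : (Q → Bool) → ℂ),
      (fun x => e x * ψ j x) = ∑ y : {y // P y}, ψ j y.1 • e y.1 • ket y.1 := by
    intro j e
    funext x
    simp only [Finset.sum_apply, Pi.smul_apply, ket, smul_eq_mul]
    by_cases hx : P x
    · rw [Finset.sum_eq_single ⟨x, hx⟩]
      · simp [mul_comm]
      · rintro ⟨y, hy⟩ - hne
        have : x ≠ y := fun h => hne (Subtype.ext h.symm)
        simp [this]
      · simp
    · rw [Finset.sum_eq_zero]
      · have : ψ j x = 0 := by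
          by_contra h0
          exact hx (hψ j x h0)
        simp [this]
      · rintro ⟨y, hy⟩ -
        have : x ≠ y := fun h => hx (h ▸ hy)
        simp [this]
  have h' := h.sum fun j y => ψ j y.1
  have h₁ : ψ = fun j => ∑ y : {y // P y}, ψ j y.1 • ket y.1 := by
    funext j
    have := key j fun _ => 1
    simpa using this
  have h₂ : (fun j x => d x * ψ j x) =
      fun j => ∑ y : {y // P y}, ψ j y.1 • d y.1 • ket y.1 := by
    funext j
    exact key j d
  rw [h₂]
  conv_lhs => rw [h₁]
  exact h'

end Implements

theorem wellFormed_layer (t : ℕ) (U : Q → Matrix.unitaryGroup Bool ℂ) (F : Q → Formula (ℕ × Q))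
    (hF : ∀ q, (F q).depth ≤ D) (M : Finset Q)
    (hv : ∀ q, ∀ v ∈ (F q).vars, v.1 = t ∧ v.2 ∈ M) :
    Circuit.WellFormed adj D t [measure M, layer U F] where
  parallel R hR step hs := by
    rcases List.mem_pair.1 hR with rfl | rfl
    · cases hs
    · obtain rfl := List.mem_singleton.1 hs
      refine List.pairwise_map.2 ((Finset.nodup_toList _).imp ?_)
      intro a b hab
      simpa [Gate.support] using hab
  causal i R hR j v hv' := by
    match i, hR with
    | 0, hR =>
      simp only [List.getElem?_cons_zero, Option.some.injEq] at hR
      subst hR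
      exact j.elim0
    | 1, hR =>
      simp only [List.getElem?_cons_succ, List.getElem?_cons_zero, Option.some.injEq] at hR
      subst hR
      exact ⟨0, measure M, one_pos, rfl, hv _ v hv'⟩
  nearest R hR step hs g hg c t h := by
    rcases List.mem_pair.1 hR with rfl | rfl
    · cases hs
    · obtain rfl := List.mem_singleton.1 hs
      obtain ⟨q, -, rfl⟩ := List.mem_map.1 hg
      cases h
  classicalDepth := by
    simp only [Circuit.ClassicalDepthLE, List.mem_cons, List.not_mem_nil, or_false,
      forall_eq_or_imp, forall_eq]
    exact ⟨fun i => i.elim0, fun i => hF _⟩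
  quantumDepth := by
    simp [Circuit.QuantumDepthLE, measure, layer]
  width_le := by
    simp [measure, layer]
  gates_le := by
    simp [measure, layer]

/-- A measurement of the qubits in `M`, followed by gates controlled by its outcomes. -/
theorem Implements.measure_correct {ι : Type*} {α β : ι → State Q} (M : Finset Q)
    (U : Q → Matrix.unitaryGroup Bool ℂ) (F : ℕ → Q → Formula (ℕ × Q))
    (hF : ∀ t q, (F t q).depth ≤ D) (hv : ∀ t q, ∀ v ∈ (F t q).vars, v.1 = t ∧ v.2 ∈ M)
    (h : ∀ t m, ∃ c : ℂ, ∀ i,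
      tensor (fun q => if (F t q).eval m then (U q : Matrix Bool Bool ℂ) else 1)
        (project M (fun q => m (t, q)) (α i)) = c • β i) : Implements adj D 2 α β := by
  intro t
  refine ⟨[measure M, layer U (F t)], le_rfl, wellFormed_layer t U _ (hF t) M (hv t), fun m => ?_⟩
  obtain ⟨c, hc⟩ := h t m
  refine ⟨c, fun i => ?_⟩
  rw [← hc, ← List.singleton_append, runFrom_append, runFrom_measure, runFrom_layer]

theorem implements_tensor {ι : Type*} (U : Q → Matrix.unitaryGroup Bool ℂ) (ψ : ι → State Q) :
    Implements adj D 2 ψ (fun i => tensor (fun q => (U q : Matrix Bool Bool ℂ)) (ψ i)) :=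
  Implements.measure_correct ∅ U (fun _ _ => .const true) (fun _ _ => Nat.zero_le _)
    (fun _ _ v hv => hv.elim) fun t m => ⟨1, fun i => by simp [Formula.eval, project_empty]⟩

theorem implements_act {ι : Type*} (U : Q → Matrix.unitaryGroup Bool ℂ) (τ : ι → Q → Bool → ℂ) :
    Implements adj D 2 (fun i => productState (τ i))
      (fun i => productState fun q => act (U q) (τ i q)) := by
  simpa only [tensor_productState] using
    implements_tensor (adj := adj) (D := D) U fun i => productState (τ i)

theorem implements_cnots {ι : Type*} (src : Q → Option Q) (h : IsMatching src)
    (hadj : ∀ q c, src q = some c → adj c q) (ψ : ι → State Q) :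
    Implements adj D 1 ψ (fun i x => ψ i (flipBy src x)) := by
  intro t
  refine ⟨[cnots src], le_rfl, ?_, fun m => ⟨1, fun i => by rw [runFrom_cnots m t src h, one_smul]⟩⟩
  constructor
  · simp only [Circuit.Parallel, List.mem_cons, List.not_mem_nil, or_false, forall_eq, cnots]
    refine List.Pairwise.filterMap _ ?_ (Finset.nodup_toList _)
    intro a a' haa b hb b' hb'
    simp only [Option.map_eq_some_iff] at hb hb'
    obtain ⟨c, hc, rfl⟩ := hb
    obtain ⟨c', hc', rfl⟩ := hb'
    have h₁ : c ≠ c' := fun e => haa (h.inj a a' c hc (e ▸ hc'))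
    have h₂ : c ≠ a' := by
      rintro rfl
      rw [h.src_src _ _ hc] at hc'
      cases hc'
    have h₃ : a ≠ c' := by
      rintro rfl
      rw [h.src_src _ _ hc'] at hc
      cases hc
    simp [Gate.support, h₁.symm, h₂.symm, h₃.symm, haa.symm]
  · intro i R hR j
    match i, hR with
    | 0, hR =>
      simp only [List.getElem?_cons_zero, Option.some.injEq] at hR
      subst hR
      exact j.elim0
  · simp only [Circuit.Local, List.mem_cons, List.not_mem_nil, or_false, forall_eq, cnots,
      List.mem_filterMap, Option.map_eq_some_iff]
    rintro g ⟨q, -, c, hc, rfl⟩ c' t' hg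
    simp only [Gate.cnot.injEq] at hg
    obtain ⟨rfl, rfl⟩ := hg
    exact hadj _ _ hc
  · simp only [Circuit.ClassicalDepthLE, List.mem_cons, List.not_mem_nil, or_false, forall_eq]
    exact fun i => i.elim0
  · simp [Circuit.QuantumDepthLE, cnots]
  · simp [cnots]
  · simp only [List.mem_cons, List.not_mem_nil, or_false, forall_eq, cnots, List.map_cons,
      List.map_nil, List.sum_cons, List.sum_nil, add_zero]
    exact (List.length_filterMap_le _ _).trans (by simp)

end Implements


/-! ## Single-qubit gates -/

section Gates

theorem mem_unitaryGroup_bool {A : Matrix Bool Bool ℂ}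
    (h : ∀ a b, ∑ i, A a i * star (A b i) = if a = b then 1 else 0) :
    A ∈ Matrix.unitaryGroup Bool ℂ := by
  rw [Matrix.mem_unitaryGroup_iff]
  ext a b
  simpa [Matrix.mul_apply, Matrix.star_apply, Matrix.one_apply] using h a b

/-- The amplitude `1/√2`. -/
noncomputable def rsqrt2 : ℂ := ((1 / Real.sqrt 2 : ℝ) : ℂ)

theorem rsqrt2_mul_self : rsqrt2 * rsqrt2 = 1 / 2 := by
  rw [rsqrt2, ← Complex.ofReal_mul, div_mul_div_comm, Real.mul_self_sqrt (by norm_num)]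
  norm_num

theorem star_rsqrt2 : star rsqrt2 = rsqrt2 := Complex.conj_ofReal _

/-- The Hadamard gate. -/
noncomputable def hadamard : Matrix.unitaryGroup Bool ℂ :=
  ⟨Matrix.of fun a b => rsqrt2 * if a && b then -1 else 1, mem_unitaryGroup_bool <| by
    have h := rsqrt2_mul_self
    intro a b
    cases a <;> cases b <;>
      simp only [Matrix.of_apply, star_mul', star_rsqrt2, Fintype.sum_bool, Bool.and_true,
        Bool.and_false, if_true, star_one, star_neg, mul_one, mul_neg, neg_mul,
        Bool.false_eq_true, if_false, h, reduceCtorEq, Bool.and_self, neg_neg] <;> norm_num⟩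

theorem hadamard_apply (a b : Bool) :
    (hadamard : Matrix Bool Bool ℂ) a b = rsqrt2 * if a && b then -1 else 1 := rfl

/-- The Pauli gate `X`. -/
def pauliX : Matrix.unitaryGroup Bool ℂ :=
  ⟨Matrix.of fun a b => if b = !a then 1 else 0, mem_unitaryGroup_bool <| by
    intro a b
    cases a <;> cases b <;> simp⟩

theorem pauliX_apply (a b : Bool) :
    (pauliX : Matrix Bool Bool ℂ) a b = if b = !a then 1 else 0 := rfl

/-- The diagonal gate with entries `1` and `e^{iθ}`. -/
noncomputable def phaseGate (θ : ℝ) : Matrix.unitaryGroup Bool ℂ :=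
  ⟨Matrix.of fun a b => if b = a then (if a then Complex.exp (θ * Complex.I) else 1) else 0,
    mem_unitaryGroup_bool <| by
      intro a b
      have h : Complex.exp (θ * Complex.I) * (starRingEnd ℂ) (Complex.exp (θ * Complex.I)) = 1 := by
        rw [Complex.mul_conj, Complex.normSq_eq_norm_sq, Complex.norm_exp_ofReal_mul_I]
        norm_num
      cases a <;> cases b <;> simp [h]⟩

theorem phaseGate_apply (θ : ℝ) (a b : Bool) : (phaseGate θ : Matrix Bool Bool ℂ) a b =
    if b = a then (if a then Complex.exp (θ * Complex.I) else 1) else 0 := rfl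

theorem act_phaseGate (θ : ℝ) (τ : Bool → ℂ) (a : Bool) :
    act (phaseGate θ) τ a = (if a then Complex.exp (θ * Complex.I) else 1) * τ a := by
  simp [act, phaseGate_apply]

theorem act_hadamard (τ : Bool → ℂ) (a : Bool) : act hadamard τ a =
    rsqrt2 * (τ false + (if a then -1 else 1) * τ true) := by
  cases a <;> simp [act, hadamard_apply] <;> ring

/-- The real rotation by the angle `β`. -/
noncomputable def rotation (β : ℝ) : Matrix.unitaryGroup Bool ℂ :=
  ⟨Matrix.of fun a b => if a = b then (Real.cos β : ℂ) else if a then (Real.sin β : ℂ)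
      else -(Real.sin β : ℂ), mem_unitaryGroup_bool <| by
    intro a b
    have h : (Real.cos β : ℂ) ^ 2 + (Real.sin β : ℂ) ^ 2 = 1 := by
      exact_mod_cast Real.cos_sq_add_sin_sq β
    cases a <;> cases b <;>
      simp [Complex.conj_ofReal, -Complex.ofReal_cos, -Complex.ofReal_sin] <;>
      first | linear_combination h | ring⟩

theorem rotation_apply (β : ℝ) (a b : Bool) : (rotation β : Matrix Bool Bool ℂ) a b =
    if a = b then (Real.cos β : ℂ) else if a then (Real.sin β : ℂ) else -(Real.sin β : ℂ) := rfl

end Gates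

/-! ## Fan-out along lines -/

/-- The role of a qubit in a family of lines of nodes, indexed by `ι`. -/
inductive Role (ι : Type) (len : ℕ) : Type
  | node : ι → Fin (len + 1) → Role ι len
  | link : ι → Fin len → Role ι len
  | other : Role ι len

/-- Whether the role is that of a link. -/
def Role.isLink {ι : Type} {len : ℕ} : Role ι len → Bool
  | .link _ _ => true
  | _ => false

/-- Whether the role is that of a node other than the first of its line. -/
def Role.isTail {ι : Type} {len : ℕ} : Role ι len → Bool
  | .node _ i => decide (i ≠ 0)
  | _ => false

/-- A family of lines of `len + 1` nodes, with an auxiliary qubit, the link, for each pair of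
consecutive nodes. -/
structure Wiring (ι : Type) (len : ℕ) (Q : Type) where
  node : ι → Fin (len + 1) → Q
  link : ι → Fin len → Q
  role : Q → Role ι len
  role_node : ∀ a i, role (node a i) = .node a i
  role_link : ∀ a i, role (link a i) = .link a i
  eq_node : ∀ {q a i}, role q = .node a i → q = node a i
  eq_link : ∀ {q a i}, role q = .link a i → q = link a i

namespace Wiring

variable {Q ι : Type} [Fintype Q] [DecidableEq Q] {len : ℕ} (W : Wiring ι len Q)

/-- Copy the value of the first node of each line to all its nodes. -/
def fan (x : Q → Bool) : Q → Bool := fun q =>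
  match W.role q with
  | .node a _ => x (W.node a 0)
  | _ => x q

/-- Add the values of the two neighbouring nodes to each link. -/
def join (x : Q → Bool) : Q → Bool := fun q =>
  match W.role q with
  | .link a i => xor (x q) (xor (x (W.node a i.castSucc)) (x (W.node a i.succ)))
  | _ => x q

/-- All nodes but the first of each line are zero. -/
def NodesClear (x : Q → Bool) : Prop := ∀ a i, i ≠ 0 → x (W.node a i) = false

/-- All links are zero. -/
def LinksClear (x : Q → Bool) : Prop := ∀ a i, x (W.link a i) = false

/-- Hadamard gates on all nodes but the first of each line. -/
noncomputable def spread (q : Q) : Matrix.unitaryGroup Bool ℂ :=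
  match W.role q with
  | .node _ i => if i = 0 then 1 else hadamard
  | _ => 1

/-- The amplitude of each basis state after a layer of Hadamard gates on the nodes. -/
noncomputable def weight (q : Q) : ℂ :=
  match W.role q with
  | .node _ i => if i = 0 then 1 else rsqrt2
  | _ => 1

/-- The links. -/
def links : Finset Q := Finset.univ.filter fun q => (W.role q).isLink

/-- The nodes other than the first of each line. -/
def tails : Finset Q := Finset.univ.filter fun q => (W.role q).isTail

theorem mem_links {q : Q} : q ∈ W.links ↔ ∃ a i, W.role q = .link a i := by
  simp only [links, Finset.mem_filter, Finset.mem_univ, true_and]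
  cases W.role q <;> simp [Role.isLink]

theorem mem_tails {q : Q} : q ∈ W.tails ↔ ∃ a i, i ≠ 0 ∧ W.role q = .node a i := by
  simp only [tails, Finset.mem_filter, Finset.mem_univ, true_and]
  cases W.role q <;> simp [Role.isTail]

/-- The corrections after the measurement of the links. -/
def linkFix (h t : ℕ) (q : Q) : Formula (ℕ × Q) :=
  match W.role q with
  | .node a i => .prefixParity (fun j => (t, W.link a j)) h i
  | .link _ _ => .var (t, q)
  | .other => .const false

/-- The corrections after the measurement of the nodes. -/
def tailFix (h t : ℕ) (q : Q) : Formula (ℕ × Q) :=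
  match W.role q with
  | .node a i =>
    if i = 0 then .prefixParity (fun j : Fin len => (t, W.node a j.succ)) h len else .var (t, q)
  | _ => .const false

/-- The Pauli gates used after the measurement of the nodes. -/
noncomputable def tailGate (q : Q) : Matrix.unitaryGroup Bool ℂ :=
  match W.role q with
  | .node _ i => if i = 0 then phaseGate Real.pi else pauliX
  | _ => pauliX

theorem prod_role [Fintype ι] (g : ι → Fin (len + 1) → ℂ) :
    (∏ q, match W.role q with
      | .node a i => g a i
      | _ => 1) = ∏ a, ∏ i, g a i := by
  rw [← Fintype.prod_prod_type']
  symm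
  refine Fintype.prod_of_injective (fun p : ι × Fin (len + 1) => W.node p.1 p.2) ?_ _ _ ?_ ?_
  · rintro ⟨a, i⟩ ⟨b, j⟩ h
    have := congrArg W.role h
    simp only [W.role_node, Role.node.injEq] at this
    exact Prod.ext this.1 this.2
  · intro q hq
    cases hr : W.role q with
    | node a i => exact absurd ⟨(a, i), (W.eq_node hr).symm⟩ hq
    | link a i => rfl
    | other => rfl
  · rintro ⟨a, i⟩
    simp only [W.role_node]

theorem eq_false_of_xor_eq_right {a b : Bool} (h : xor a b = b) : a = false := by
  cases a <;> cases b <;> simp_all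

variable {adj : Q → Q → Prop} {D : ℕ}

/-- Hadamard gates put all nodes but the first in uniform superposition, and measuring the links
reveals the exclusive or of each pair of consecutive nodes. Node `i` then differs from the first
node by the parity of the first `i` outcomes, which the corrections remove. The links are reset to
zero, so they can serve again. -/
theorem implements_fan {h l : ℕ} (hh : len ≤ 2 ^ h) (hD : 3 * h ≤ D)
    (hK : Implements adj D l (id : State Q → State Q) fun ψ x => ψ (W.join x)) :
    Implements adj D (2 + l + 2)
      (fun y : {y // W.NodesClear y ∧ W.LinksClear y} => ket y.1) (fun y => ket (W.fan y.1)) := by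
  have h₁ : Implements adj D 2 (fun y : {y // W.NodesClear y ∧ W.LinksClear y} => ket y.1)
      (fun y => productState fun q => act (W.spread q) (bit (y.1 q))) := by
    simp only [ket_eq_productState]
    exact implements_act W.spread fun (y : {y // W.NodesClear y ∧ W.LinksClear y}) q => bit (y.1 q)
  refine (h₁.trans (hK.comp _)).trans ?_
  refine Implements.measure_correct W.links (fun _ => pauliX) (W.linkFix h) ?_ ?_ ?_
  · intro t q
    unfold linkFix
    split
    · exact (Formula.depth_prefixParity _ _ _).trans hD
    · exact Nat.zero_le _
    · exact Nat.zero_le _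
  · intro t q v hv
    unfold linkFix at hv
    split at hv
    · obtain ⟨i, rfl⟩ := Formula.vars_prefixParity _ _ _ hv
      exact ⟨rfl, W.mem_links.2 ⟨_, _, W.role_link _ _⟩⟩
    · obtain rfl := hv
      exact ⟨rfl, W.mem_links.2 ⟨_, _, ‹_›⟩⟩
    · exact hv.elim
  · intro t m
    -- One factor `1/√2` for each node other than the first of its line, whatever the outcomes and
    -- the input.
    refine ⟨∏ q, W.weight q, ?_⟩
    rintro ⟨y, hyn, hyl⟩
    funext x
    set s : Q → Bool := fun q => (W.linkFix h t q).eval m with hs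
    rw [tensor_monomial _ s (fun _ _ => 1)]
    swap
    · intro q a b
      cases hb : s q <;> simp only [hs] at hb <;>
        simp [hb, pauliX_apply, Matrix.one_apply, eq_comm]
    set z : Q → Bool := fun q => xor (x q) (s q) with hz
    simp only [Finset.prod_const_one, one_mul, project, act_bit, Pi.smul_apply, ket, smul_eq_mul,
      mul_ite, mul_one, mul_zero]
    -- Running parity of the link outcomes of a line: before the correction, node `i` holds the
    -- first node's value flipped by `pre a i`.
    set pre : ι → ℕ → Bool :=
      fun a => parity (fun i => if hi : i < len then m (t, W.link a ⟨i, hi⟩) else false) 0 with hpre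
    have hpre_succ : ∀ a (i : Fin len), pre a (i + 1) = xor (pre a i) (m (t, W.link a i)) := by
      intro a i
      simp [hpre, parity]
    have hsn : ∀ a i, s (W.node a i) = pre a i := by
      intro a i
      simp only [hs, linkFix, W.role_node]
      exact Formula.eval_prefixParity _ _ _ _ (by omega) hh
    have hsl : ∀ a i, s (W.link a i) = m (t, W.link a i) := by
      intro a i
      simp [hs, linkFix, W.role_link, Formula.eval]
    have hso : ∀ q, W.role q = .other → s q = false := by
      intro q hq
      simp [hs, linkFix, hq, Formula.eval]
    by_cases hx : x = W.fan y
    · have hxn : ∀ a i, x (W.node a i) = y (W.node a 0) := by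
        intro a i
        rw [hx, fan]
        simp only [W.role_node]
      have hxl : ∀ a i, x (W.link a i) = false := by
        intro a i
        rw [hx, fan]
        simp only [W.role_link, hyl a i]
      have hxo : ∀ q, W.role q = .other → x q = y q := by
        intro q hq
        rw [hx, fan]
        simp only [hq]
      rw [if_pos hx, if_pos]
      · refine Finset.prod_congr rfl fun q _ => ?_
        cases hr : W.role q with
        | other => simp [spread, weight, join, hr, hz, hso q hr, hxo q hr]
        | node a i =>
          obtain rfl := W.eq_node hr
          by_cases hi : i = 0
          · subst hi
            simp [spread, weight, join, W.role_node, hz, hsn, hxn, hpre, parity]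
          · simp [spread, weight, W.role_node, hi, hadamard_apply, hyn a i hi]
        | link a i =>
          obtain rfl := W.eq_link hr
          simp [spread, weight, join, W.role_link, hz, hsn, hxn, hsl, hxl, hyl a i, hpre_succ,
            Matrix.one_apply]
          cases y (W.node a 0) <;> cases pre a i <;> cases m (t, W.link a i) <;> rfl
      · intro q hq
        obtain ⟨a, i, hr⟩ := W.mem_links.1 hq
        obtain rfl := W.eq_link hr
        simp [hz, hxl, hsl]
    · rw [if_neg hx]
      split_ifs with hM
      swap
      · rfl
      -- If all factors are nonzero, the untouched qubits and the first nodes agree with `y`, and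
      -- the link factors force consecutive nodes to be equal, so `x` has to be the fanned-out
      -- string.
      by_contra hne
      apply hx
      replace hne := Finset.prod_ne_zero_iff.1 hne
      have hxl : ∀ a i, x (W.link a i) = false := by
        intro a i
        have := hM _ (W.mem_links.2 ⟨a, i, W.role_link a i⟩)
        simp only [hz, hsl] at this
        exact eq_false_of_xor_eq_right this
      have hxo : ∀ q, W.role q = .other → x q = y q := by
        intro q hq
        have := hne q (Finset.mem_univ _)
        simpa [spread, join, hq, hz, hso q hq, Matrix.one_apply] using this
      have hx0 : ∀ a, x (W.node a 0) = y (W.node a 0) := by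
        intro a
        have := hne (W.node a 0) (Finset.mem_univ _)
        simpa [spread, join, W.role_node, hz, hsn, hpre, parity, Matrix.one_apply] using this
      have hstep : ∀ a (i : Fin len), x (W.node a i.succ) = x (W.node a i.castSucc) := by
        intro a i
        have := hne (W.link a i) (Finset.mem_univ _)
        simp [spread, join, W.role_link, hz, hsn, hsl, hxl, hpre_succ, Matrix.one_apply, hyl a i]
          at this
        revert this
        cases x (W.node a i.castSucc) <;> cases x (W.node a i.succ) <;> cases pre a i <;>
          cases m (t, W.link a i) <;> simp
      have hxn : ∀ a i, x (W.node a i) = y (W.node a 0) := by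
        intro a i
        induction i using Fin.induction with
        | zero => exact hx0 a
        | succ i ih => rw [hstep, ih]
      funext q
      cases hr : W.role q with
      | other => simp [fan, hr, hxo q hr]
      | node a i =>
        obtain rfl := W.eq_node hr
        simp [fan, hr, hxn]
      | link a i =>
        obtain rfl := W.eq_link hr
        simp [fan, hr, hxl, hyl a i]

theorem prod_sign_eq_parity (g : ℕ → Bool) (b : Bool) (n : ℕ) :
    (∏ i ∈ Finset.range n, if g i && b then (-1 : ℂ) else 1) =
      if parity g 0 n && b then -1 else 1 := by
  induction n with
  | zero => simp [parity]
  | succ n ih =>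
    rw [Finset.prod_range_succ, ih, parity, zero_add]
    cases parity g 0 n <;> cases g n <;> cases b <;> simp

/-- A copy of the bit `b`, measured after a Hadamard gate with outcome `m`, leaves the sign `(-1)^(m
b)`. Along a line the signs multiply to `(-1)^b` raised to the parity of the outcomes, which a `Z`
gate on the first node cancels; the measured nodes are reset by `X`. -/
theorem implements_fan_inverse [Fintype ι] {h : ℕ} (hh : len ≤ 2 ^ h) (hD : 3 * h ≤ D) :
    Implements adj D 4
      (fun y : {y // W.NodesClear y} => ket (W.fan y.1)) (fun y => ket y.1) := by
  have h₁ : Implements adj D 2 (fun y : {y // W.NodesClear y} => ket (W.fan y.1))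
      (fun y => productState fun q => act (W.spread q) (bit (W.fan y.1 q))) := by
    simp only [ket_eq_productState]
    exact implements_act W.spread fun (y : {y // W.NodesClear y}) q => bit (W.fan y.1 q)
  refine h₁.trans (l₂ := 2) ?_
  refine Implements.measure_correct W.tails W.tailGate (W.tailFix h) ?_ ?_ ?_
  · intro t q
    unfold tailFix
    split
    · split_ifs
      · exact (Formula.depth_prefixParity _ _ _).trans hD
      · exact Nat.zero_le _
    · exact Nat.zero_le _
  · intro t q v hv
    unfold tailFix at hv
    split at hv
    · split_ifs at hv
      · obtain ⟨i, rfl⟩ := Formula.vars_prefixParity _ _ _ hv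
        exact ⟨rfl, W.mem_tails.2 ⟨_, _, Fin.succ_ne_zero i, W.role_node _ _⟩⟩
      · obtain rfl := hv
        exact ⟨rfl, W.mem_tails.2 ⟨_, _, ‹_›, ‹_›⟩⟩
    · exact hv.elim
  · intro t m
    refine ⟨∏ q, W.weight q, ?_⟩
    rintro ⟨y, hyn⟩
    funext x
    set par : ι → Bool := fun a => parity
      (fun i => if hi : i < len then m (t, W.node a (Fin.succ ⟨i, hi⟩)) else false) 0 len with hpar
    have heval : ∀ a, (Formula.prefixParity (fun j : Fin len => (t, W.node a j.succ)) h len).eval m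
        = par a := fun a => Formula.eval_prefixParity _ _ _ _ le_rfl hh
    set s : Q → Bool := fun q => match W.role q with
      | .node a i => if i = 0 then false else m (t, q)
      | _ => false with hs
    set d : Q → Bool → ℂ := fun q b => match W.role q with
      | .node a i => if i = 0 then (if par a && b then -1 else 1) else 1
      | _ => 1 with hd
    rw [tensor_monomial _ s d]
    swap
    · intro q a b
      cases hr : W.role q with
      | other =>
        cases a <;> cases b <;> simp [hs, hd, tailFix, hr, Formula.eval]
      | link a' i =>
        cases a <;> cases b <;> simp [hs, hd, tailFix, hr, Formula.eval]
      | node a' i =>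
        by_cases hi : i = 0
        · subst hi
          simp only [hs, hd, tailFix, tailGate, hr, if_true, heval]
          cases par a' <;> cases a <;> cases b <;>
            simp [phaseGate_apply, Complex.exp_pi_mul_I]
        · simp only [hs, hd, tailFix, tailGate, hr, hi, if_false, Formula.eval]
          cases m (t, q) <;> cases a <;> cases b <;> simp [pauliX_apply]
    set z : Q → Bool := fun q => xor (x q) (s q) with hz
    simp only [project, productState, act_bit, Pi.smul_apply, ket,
      smul_eq_mul, mul_ite, mul_one, mul_zero]
    by_cases hx : x = y
    · subst hx
      rw [if_pos rfl, if_pos, ← Finset.prod_mul_distrib]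
      · have key : ∀ q, d q (x q) * (W.spread q : Matrix Bool Bool ℂ) (z q) (W.fan x q) =
            W.weight q * match W.role q with
              | .node a i => if i = 0 then (if par a && x (W.node a 0) then -1 else 1) else
                  if m (t, W.node a i) && x (W.node a 0) then -1 else 1
              | _ => 1 := by
          intro q
          cases hr : W.role q with
          | other => simp [hs, hd, hz, spread, weight, fan, hr]
          | link a' i => simp [hs, hd, hz, spread, weight, fan, hr]
          | node a i =>
            obtain rfl := W.eq_node hr
            by_cases hi : i = 0
            · subst hi
              simp [hs, hd, hz, spread, weight, fan, hr]
            · simp [hs, hd, hz, spread, weight, fan, hr, hi, hyn a i hi, hadamard_apply]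
        rw [Finset.prod_congr rfl fun q _ => key q, Finset.prod_mul_distrib,
          W.prod_role fun a i => if i = 0 then (if par a && x (W.node a 0) then -1 else 1) else
                  if m (t, W.node a i) && x (W.node a 0) then -1 else 1]
        convert mul_one _
        refine Finset.prod_eq_one fun a _ => ?_
        rw [Fin.prod_univ_succ]
        have hp := prod_sign_eq_parity
          (fun i => if hi : i < len then m (t, W.node a (Fin.succ ⟨i, hi⟩)) else false)
          (x (W.node a 0)) len
        rw [Finset.prod_range] at hp
        simp only [Fin.is_lt, dite_true] at hp
        simp only [if_true, Fin.succ_ne_zero, if_false]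
        rw [hp]
        simp only [hpar]
        split_ifs <;> norm_num
      · intro q hq
        obtain ⟨a, i, hi, hr⟩ := W.mem_tails.1 hq
        obtain rfl := W.eq_node hr
        simp [hz, hs, hr, hi, hyn a i hi]
    · rw [if_neg hx]
      split_ifs with hM
      swap
      · rfl
      by_contra hne
      apply hx
      have hne' := Finset.prod_ne_zero_iff.1 (right_ne_zero_of_mul hne)
      funext q
      have hq := hne' q (Finset.mem_univ _)
      cases hr : W.role q with
      | other => simpa [spread, fan, hr, hz, hs, Matrix.one_apply] using hq
      | link a i => simpa [spread, fan, hr, hz, hs, Matrix.one_apply] using hq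
      | node a i =>
        obtain rfl := W.eq_node hr
        by_cases hi : i = 0
        · subst hi
          simpa [spread, fan, hr, hz, hs, Matrix.one_apply] using hq
        · have := hM _ (W.mem_tails.2 ⟨a, i, hi, hr⟩)
          rw [hyn a i hi]
          simp only [hz, hs, hr, hi, if_false] at this
          exact eq_false_of_xor_eq_right this

end Wiring


/-! ## The layout of the qubits -/

/-- The columns of the grid: a store, nodes `u i`, links `l t`, and nodes `v t`. -/
inductive Column (k : ℕ) : Type
  | st : Column k
  | u : Fin (k + 1) → Column k
  | l : Fin k → Column k
  | v : Fin k → Column k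
  deriving DecidableEq

namespace Column

variable {k : ℕ}

/-- The four kinds of columns. -/
def equivSum (k : ℕ) : Unit ⊕ Fin (k + 1) ⊕ Fin k ⊕ Fin k ≃ Column k where
  toFun
    | .inl _ => st
    | .inr (.inl i) => u i
    | .inr (.inr (.inl t)) => l t
    | .inr (.inr (.inr t)) => v t
  invFun
    | st => .inl ()
    | u i => .inr (.inl i)
    | l t => .inr (.inr (.inl t))
    | v t => .inr (.inr (.inr t))
  left_inv := by rintro (_ | _ | _ | _) <;> rfl
  right_inv := by rintro (_ | _ | _ | _) <;> rfl

instance : Fintype (Column k) := Fintype.ofEquiv _ (equivSum k)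

theorem prod_univ (g : Column k → ℂ) :
    ∏ c, g c = g st * ((∏ i, g (u i)) * ((∏ t, g (l t)) * ∏ t, g (v t))) := by
  rw [← (equivSum k).prod_comp g]
  simp only [Fintype.prod_sum_type, Finset.univ_unique, Finset.prod_singleton]
  rfl

/-- The position of a column on the grid. -/
def pos : Column k → Fin (3 * k + 2)
  | st => ⟨0, by omega⟩
  | u i => ⟨1 + 3 * i, by omega⟩
  | l t => ⟨2 + 3 * t, by omega⟩
  | v t => ⟨3 + 3 * t, by omega⟩

theorem pos_injective : Function.Injective (pos : Column k → Fin (3 * k + 2)) := by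
  intro a b h
  cases a <;> cases b <;> simp only [pos, Fin.mk.injEq] at h <;>
    first
    | rfl
    | omega
    | (congr 1; apply Fin.ext; omega)

theorem card_column : Fintype.card (Column k) = 3 * k + 2 := by
  rw [← Fintype.card_congr (equivSum k)]
  simp only [Fintype.card_sum, Fintype.card_unit, Fintype.card_fin]
  omega

end Column

/-- The qubits, in `N + 1` rows. -/
abbrev Cell (N k : ℕ) : Type := Fin (N + 1) × Column k

/-- The qubits of the layout as the qubits of the grid. -/
noncomputable def cellEquiv (N k : ℕ) : Cell N k ≃ Grid (N + 1) (3 * k + 2) :=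
  (Equiv.refl _).prodCongr (Equiv.ofBijective Column.pos
    ((Fintype.bijective_iff_injective_and_card _).2
      ⟨Column.pos_injective, by rw [Column.card_column, Fintype.card_fin]⟩))

/-- Neighbours on the grid. -/
def Cell.Adj {N k : ℕ} (p q : Cell N k) : Prop := Grid.Adj (cellEquiv N k p) (cellEquiv N k q)

namespace Cell

variable {N k : ℕ}

theorem adj_iff {p q : Cell N k} : Cell.Adj p q ↔
    (p.1 = q.1 ∧ ((p.2.pos : ℕ) + 1 = q.2.pos ∨ (q.2.pos : ℕ) + 1 = p.2.pos)) ∨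
    (p.2.pos = q.2.pos ∧ ((p.1 : ℕ) + 1 = q.1 ∨ (q.1 : ℕ) + 1 = p.1)) := Iff.rfl

/-- Each row is a line with nodes in the columns `u i`. -/
def rows (N k : ℕ) : Wiring (Fin (N + 1)) k (Cell N k) where
  node j i := (j, .u i)
  link j t := (j, .l t)
  role
    | (j, .u i) => .node j i
    | (j, .l t) => .link j t
    | _ => .other
  role_node _ _ := rfl
  role_link _ _ := rfl
  eq_node := by rintro ⟨j, _ | _ | _ | _⟩ a i h <;> simp_all
  eq_link := by rintro ⟨j, _ | _ | _ | _⟩ a i h <;> simp_all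

/-- Each column `v t` is a line. -/
def columns (N k : ℕ) : Wiring (Fin k) N (Cell N k) where
  node t j := (j, .v t)
  link t j := (j.castSucc, .l t)
  role
    | (j, .v t) => .node t j
    | (j, .l t) => if h : (j : ℕ) < N then .link t ⟨j, h⟩ else .other
    | _ => .other
  role_node _ _ := rfl
  role_link a i := by simp
  eq_node := by
    rintro ⟨j, _ | _ | t | _⟩ a i h
    · simp_all
    · simp_all
    · dsimp only at h
      split_ifs at h
    · simp_all
  eq_link := by
    rintro ⟨j, _ | _ | t | _⟩ a i h
    · simp_all
    · simp_all
    · dsimp only at h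
      split_ifs at h
      simp only [Role.link.injEq] at h
      obtain ⟨rfl, rfl⟩ := h
      rfl
    · simp_all

/-- Gates from `u t` to the link `l t`. -/
def srcUL : Cell N k → Option (Cell N k)
  | (j, .l t) => some (j, .u t.castSucc)
  | _ => none

/-- Gates from `u (t + 1)` to `v t`. -/
def srcUV : Cell N k → Option (Cell N k)
  | (j, .v t) => some (j, .u t.succ)
  | _ => none

/-- Gates from `v t` to the link `l t`. -/
def srcVL : Cell N k → Option (Cell N k)
  | (j, .l t) => some (j, .v t)
  | _ => none

/-- Gates from each `v t` to the one above it, in every second row. -/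
def srcVV (p : ℕ) : Cell N k → Option (Cell N k)
  | (j, .v t) => if h : (j : ℕ) % 2 = p ∧ (j : ℕ) < N then some (⟨j + 1, by omega⟩, .v t) else none
  | _ => none

/-- Gates from `v t` to the link `l t`, in every second row. -/
def srcVLHalf (p : ℕ) : Cell N k → Option (Cell N k)
  | (j, .l t) => if (j : ℕ) % 2 = p ∧ (j : ℕ) < N then some (j, .v t) else none
  | _ => none

theorem isMatching_srcUL : IsMatching (srcUL : Cell N k → _) := by
  constructor
  · rintro ⟨j, _ | _ | _ | _⟩ c h <;> simp only [srcUL, reduceCtorEq, Option.some.injEq] at h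
    subst h
    rfl
  · rintro ⟨j, _ | _ | _ | _⟩ ⟨j', _ | _ | _ | _⟩ c h h' <;>
      simp only [srcUL, reduceCtorEq, Option.some.injEq] at h h'
    subst h
    simp_all

theorem isMatching_srcUV : IsMatching (srcUV : Cell N k → _) := by
  constructor
  · rintro ⟨j, _ | _ | _ | _⟩ c h <;> simp only [srcUV, reduceCtorEq, Option.some.injEq] at h
    subst h
    rfl
  · rintro ⟨j, _ | _ | _ | _⟩ ⟨j', _ | _ | _ | _⟩ c h h' <;>
      simp only [srcUV, reduceCtorEq, Option.some.injEq] at h h'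
    subst h
    simp_all

theorem isMatching_srcVL : IsMatching (srcVL : Cell N k → _) := by
  constructor
  · rintro ⟨j, _ | _ | _ | _⟩ c h <;> simp only [srcVL, reduceCtorEq, Option.some.injEq] at h
    subst h
    rfl
  · rintro ⟨j, _ | _ | _ | _⟩ ⟨j', _ | _ | _ | _⟩ c h h' <;>
      simp only [srcVL, reduceCtorEq, Option.some.injEq] at h h'
    subst h
    simp_all

theorem isMatching_srcVLHalf (p : ℕ) : IsMatching (srcVLHalf p : Cell N k → _) := by
  constructor
  · rintro ⟨j, _ | _ | _ | _⟩ c h <;> simp only [srcVLHalf, reduceCtorEq] at h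
    split_ifs at h
    simp only [Option.some.injEq] at h
    subst h
    rfl
  · rintro ⟨j, _ | _ | _ | _⟩ ⟨j', _ | _ | _ | _⟩ c h h' <;>
      simp only [srcVLHalf, reduceCtorEq] at h h'
    split_ifs at h h'
    simp only [Option.some.injEq] at h h'
    subst h
    simp_all

theorem isMatching_srcVV (p : ℕ) : IsMatching (srcVV p : Cell N k → _) := by
  constructor
  · rintro ⟨j, _ | _ | _ | _⟩ c h <;> simp only [srcVV, reduceCtorEq] at h
    split_ifs at h
    simp only [Option.some.injEq] at h
    subst h
    have : ¬ (((j : ℕ) + 1) % 2 = p ∧ (j : ℕ) + 1 < N) := by omega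
    simp only [srcVV, this, dite_false]
  · rintro ⟨j, _ | _ | _ | _⟩ ⟨j', _ | _ | _ | _⟩ c h h' <;>
      simp only [srcVV, reduceCtorEq] at h h'
    split_ifs at h h'
    simp only [Option.some.injEq] at h h'
    subst h
    simp only [Prod.mk.injEq, Fin.mk.injEq, Column.v.injEq] at h'
    obtain ⟨h₁, rfl⟩ := h'
    have : j = j' := Fin.ext (by omega)
    rw [this]

theorem adj_srcUL (q c : Cell N k) (h : srcUL q = some c) : Cell.Adj c q := by
  obtain ⟨j, _ | _ | _ | _⟩ := q <;> simp only [srcUL, reduceCtorEq, Option.some.injEq] at h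
  subst h
  simp only [adj_iff, Column.pos, Fin.val_castSucc, true_and]
  left
  left
  show 1 + 3 * _ + 1 = 2 + 3 * _
  omega

theorem adj_srcUV (q c : Cell N k) (h : srcUV q = some c) : Cell.Adj c q := by
  obtain ⟨j, _ | _ | _ | _⟩ := q <;> simp only [srcUV, reduceCtorEq, Option.some.injEq] at h
  subst h
  simp only [adj_iff, Column.pos, Fin.val_succ, Fin.val_mk, true_and]
  left
  right
  show 3 + 3 * _ + 1 = 1 + 3 * (_ + 1)
  omega

theorem adj_srcVL (q c : Cell N k) (h : srcVL q = some c) : Cell.Adj c q := by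
  obtain ⟨j, _ | _ | _ | _⟩ := q <;> simp only [srcVL, reduceCtorEq, Option.some.injEq] at h
  subst h
  simp only [adj_iff, Column.pos, true_and]
  left
  right
  show 2 + 3 * _ + 1 = 3 + 3 * _
  omega

theorem adj_srcVLHalf (p : ℕ) (q c : Cell N k) (h : srcVLHalf p q = some c) : Cell.Adj c q := by
  obtain ⟨j, _ | _ | _ | _⟩ := q <;> simp only [srcVLHalf, reduceCtorEq] at h
  split_ifs at h
  simp only [Option.some.injEq] at h
  subst h
  simp only [adj_iff, Column.pos, true_and]
  left
  right
  show 2 + 3 * _ + 1 = 3 + 3 * _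
  omega

theorem adj_srcVV (p : ℕ) (q c : Cell N k) (h : srcVV p q = some c) : Cell.Adj c q := by
  obtain ⟨j, _ | _ | _ | _⟩ := q <;> simp only [srcVV, reduceCtorEq] at h
  split_ifs at h
  simp only [Option.some.injEq] at h
  subst h
  simp [adj_iff, Column.pos]

/-- The cell `v t` separates the link `l t` from `u (t + 1)` and acts as a relay. The link receives
`v + u (t + 1)` once and the restored `v` once, so the unknown content of `v` cancels. -/
theorem implements_rows_join {D : ℕ} : Implements Cell.Adj D (1 + 1 + 1 + 1 + 1)
    (id : State (Cell N k) → State (Cell N k)) fun ψ x => ψ ((rows N k).join x) := by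
  have h := ((((implements_cnots (D := D) srcUL isMatching_srcUL adj_srcUL
    (id : State (Cell N k) → State (Cell N k))).trans
      (implements_cnots srcUV isMatching_srcUV adj_srcUV _)).trans
      (implements_cnots srcVL isMatching_srcVL adj_srcVL _)).trans
      (implements_cnots srcUV isMatching_srcUV adj_srcUV _)).trans
      (implements_cnots srcVL isMatching_srcVL adj_srcVL _)
  convert h using 4 with ψ x
  refine congrArg ψ ?_
  funext ⟨j, c⟩
  cases c with
  | l t =>
    simp only [Wiring.join, rows, flipBy, srcUL, srcUV, srcVL]
    cases x (j, .l t) <;> cases x (j, .u t.castSucc) <;> cases x (j, .u t.succ) <;>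
      cases x (j, .v t) <;> rfl
  | v t =>
    simp only [Wiring.join, rows, flipBy, srcUL, srcUV, srcVL]
    cases x (j, .u t.succ) <;> cases x (j, .v t) <;> rfl
  | u i => rfl
  | st => rfl

/-- Add the values of the neighbouring nodes to the links in every second row. -/
def joinHalf (p : ℕ) (x : Cell N k → Bool) : Cell N k → Bool
  | (j, .l t) =>
    if h : (j : ℕ) % 2 = p ∧ (j : ℕ) < N then
      xor (x (j, .l t)) (xor (x (j, .v t)) (x (⟨j + 1, by omega⟩, .v t)))
    else x (j, .l t)
  | q => x q

theorem flipBy_srcVV_v (p : ℕ) (x : Cell N k → Bool) (j : Fin (N + 1)) (t : Fin k) :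
    flipBy (srcVV p) x (j, .v t) = if h : (j : ℕ) % 2 = p ∧ (j : ℕ) < N then
      xor (x (j, .v t)) (x (⟨j + 1, by omega⟩, .v t)) else x (j, .v t) := by
  by_cases h : (j : ℕ) % 2 = p ∧ (j : ℕ) < N <;> simp [flipBy, srcVV, h]

theorem flipBy_srcVLHalf_l (p : ℕ) (x : Cell N k → Bool) (j : Fin (N + 1)) (t : Fin k) :
    flipBy (srcVLHalf p) x (j, .l t) = if (j : ℕ) % 2 = p ∧ (j : ℕ) < N then
      xor (x (j, .l t)) (x (j, .v t)) else x (j, .l t) := by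
  by_cases h : (j : ℕ) % 2 = p ∧ (j : ℕ) < N <;> simp [flipBy, srcVLHalf, h]

/-- The cell `v t` in row `j` temporarily holds the sum of rows `j` and `j + 1`, which is added to
the link beside it before the cell is restored. -/
theorem flipBy_eq_joinHalf (p : ℕ) (x : Cell N k → Bool) :
    flipBy (srcVV p) (flipBy (srcVLHalf p) (flipBy (srcVV p) x)) = joinHalf p x := by
  have hl : ∀ (x : Cell N k → Bool) j t, flipBy (srcVV p) x (j, .l t) = x (j, .l t) :=
    fun _ _ _ => rfl
  have hv : ∀ (x : Cell N k → Bool) j t, flipBy (srcVLHalf p) x (j, .v t) = x (j, .v t) :=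
    fun _ _ _ => rfl
  funext ⟨j, c⟩
  cases c with
  | l t =>
    rw [hl, flipBy_srcVLHalf_l, hl, flipBy_srcVV_v]
    by_cases h : (j : ℕ) % 2 = p ∧ (j : ℕ) < N <;> simp [joinHalf, h]
  | v t =>
    rw [flipBy_srcVV_v]
    simp only [hv, flipBy_srcVV_v, joinHalf]
    by_cases h : (j : ℕ) % 2 = p ∧ (j : ℕ) < N
    -- Row `j + 1` has the other parity, so its cell is not a target, and the same bit is added both
    -- times.
    · have h' : ¬ (((j : ℕ) + 1) % 2 = p ∧ (j : ℕ) + 1 < N) := by omega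
      simp [h, h']
    · simp [h]
  | u i => rfl
  | st => rfl

theorem joinHalf_joinHalf (x : Cell N k → Bool) :
    joinHalf 0 (joinHalf 1 x) = (columns N k).join x := by
  funext ⟨j, c⟩
  cases c with
  | l t =>
    by_cases hj : (j : ℕ) < N
    · have hlink : (columns N k).role (j, .l t) = .link t ⟨j, hj⟩ := by
        simp [columns, hj]
      rcases Nat.mod_two_eq_zero_or_one j with hp | hp <;>
        simp [Wiring.join, hlink, joinHalf, hp, hj] <;> rfl
    · have hlink : (columns N k).role (j, .l t) = .other := by
        simp [columns, hj]
      simp [Wiring.join, hlink, joinHalf, hj]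
  | v t => rfl
  | u i => rfl
  | st => rfl

/-- Inside a column an interior node would be the target of one gate and the control of another.
Treating even and odd rows separately makes each layer a matching. -/
theorem implements_columns_join {D : ℕ} : Implements Cell.Adj D (1 + 1 + 1 + (1 + 1 + 1))
    (id : State (Cell N k) → State (Cell N k)) fun ψ x => ψ ((columns N k).join x) := by
  have h : ∀ (p : ℕ) (ψ : State (Cell N k) → State (Cell N k)),
      Implements Cell.Adj D (1 + 1 + 1) ψ fun i x => ψ i (joinHalf p x) := by
    intro p ψ
    have h := ((implements_cnots (D := D) (srcVV p) (isMatching_srcVV p) (adj_srcVV p) ψ).trans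
      (implements_cnots (srcVLHalf p) (isMatching_srcVLHalf p) (adj_srcVLHalf p) _)).trans
      (implements_cnots (srcVV p) (isMatching_srcVV p) (adj_srcVV p) _)
    simpa only [flipBy_eq_joinHalf] using h
  have h' := (h 0 id).trans (h 1 _)
  simpa only [joinHalf_joinHalf, id] using h'

end Cell


/-! ### Layers of phase gates and their conjugation by CNOT gates. -/

section Phases

variable {Q : Type} [Fintype Q] [DecidableEq Q] {adj : Q → Q → Prop} {D : ℕ}

/-- The total phase of a layer of phase gates with angles `θ` on a basis state. -/
noncomputable def layerPhase (θ : Q → ℝ) (x : Q → Bool) : ℂ :=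
  ∏ q, if x q then Complex.exp (θ q * Complex.I) else 1

theorem implements_layerPhase {ι : Type*} (θ : Q → ℝ) (ψ : ι → State Q) :
    Implements adj D 2 ψ (fun i x => layerPhase θ x * ψ i x) := by
  have h := implements_tensor (adj := adj) (D := D) (fun q => phaseGate (θ q)) ψ
  convert h using 3 with i x
  rw [tensor_monomial _ (fun _ => false)
    (fun q a => if a then Complex.exp (θ q * Complex.I) else 1)]
  · simp [layerPhase]
  · intro q a b
    simp [phaseGate_apply]

theorem flipBy_flipBy {src : Q → Option Q} (h : IsMatching src) (x : Q → Bool) :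
    flipBy src (flipBy src x) = x := by
  funext q
  cases hq : src q with
  | none => simp [flipBy, hq]
  | some c => simp [flipBy, hq, h.src_src q c hq]

/-- Phase gates, CNOT gates, phase gates, and the same CNOT gates again. -/
theorem implements_conjugated_phase {ι : Type*} {src : Q → Option Q} (h : IsMatching src)
    (hadj : ∀ q c, src q = some c → adj c q) (θ φ : Q → ℝ) (ψ : ι → State Q) :
    Implements adj D 6 ψ
      (fun i x => (layerPhase φ (flipBy src x) * layerPhase θ x) * ψ i x) := by
  have h' := (((implements_layerPhase (adj := adj) (D := D) θ ψ).trans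
    (implements_cnots src h hadj _)).trans (implements_layerPhase φ _)).trans
    (implements_cnots src h hadj _)
  simpa only [flipBy_flipBy h, mul_assoc] using h'

end Phases

/-! ## Coupling a qubit of each row to a qubit of each column -/

namespace Cell

variable {N k : ℕ} {D : ℕ}

/-- All qubits outside the registers are zero. -/
structure Clear (x : Cell N k → Bool) : Prop where
  u : ∀ j i, i ≠ 0 → x (j, .u i) = false
  l : ∀ j t, x (j, .l t) = false
  v : ∀ j t, j ≠ 0 → x (j, .v t) = false

/-- The phase `∏ e^{i θ j t u_j v_t}`. -/
noncomputable def couple (θ : Fin (N + 1) → Fin k → ℝ) (u : Fin (N + 1) → Bool)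
    (v : Fin k → Bool) : ℂ :=
  ∏ j, ∏ t, if u j && v t then Complex.exp (θ j t * Complex.I) else 1

/-- The values of a basis state on the store. -/
def regS (x : Cell N k → Bool) (j : Fin (N + 1)) : Bool := x (j, .st)

/-- The values of a basis state on the row register. -/
def regU (x : Cell N k → Bool) (j : Fin (N + 1)) : Bool := x (j, .u 0)

/-- The values of a basis state on the column register. -/
def regV (x : Cell N k → Bool) (t : Fin k) : Bool := x (0, .v t)

theorem prod_cell (g : Cell N k → ℂ) : ∏ q, g q =
    (∏ j, g (j, .st)) * ((∏ j, ∏ i, g (j, .u i)) * ((∏ j, ∏ t, g (j, .l t)) *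
      ∏ j, ∏ t, g (j, .v t))) := by
  rw [Fintype.prod_prod_type]
  simp only [Column.prod_univ, Finset.prod_mul_distrib]

/-- Angles of the first layer of phase gates. -/
noncomputable def angle₁ (θ : Fin (N + 1) → Fin k → ℝ) : Cell N k → ℝ
  | (j, .u i) => Fin.cases 0 (fun t => θ j t / 2) i
  | (j, .v t) => θ j t / 2
  | _ => 0

/-- Angles of the second layer of phase gates. -/
noncomputable def angle₂ (θ : Fin (N + 1) → Fin k → ℝ) : Cell N k → ℝ
  | (j, .v t) => - (θ j t / 2)
  | _ => 0

/-- Uses `u v = (u + v - (u xor v)) / 2`. At the crossing of row `j` and column `t` the copies of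
`u` and `v` each receive the angle `θ / 2`, and the `v` cell receives `-θ / 2` while it holds `u xor
v`. -/
theorem layerPhase_angle (θ : Fin (N + 1) → Fin k → ℝ) (x : Cell N k → Bool) :
    layerPhase (angle₂ θ) (flipBy srcUV ((columns N k).fan ((rows N k).fan x))) *
      layerPhase (angle₁ θ) ((columns N k).fan ((rows N k).fan x)) =
      couple θ (regU x) (regV x) := by
  set w := (columns N k).fan ((rows N k).fan x) with hw
  have hwu : ∀ j i, w (j, .u i) = regU x j := fun j i => rfl
  have hwv : ∀ j t, w (j, .v t) = regV x t := fun j i => rfl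
  have hfv : ∀ j t, flipBy srcUV w (j, .v t) = xor (regV x t) (regU x j) := fun j i => rfl
  simp only [layerPhase, prod_cell]
  simp only [angle₁, angle₂, hwu, hwv, hfv, Fin.prod_univ_succ (n := k), Fin.cases_zero,
    Fin.cases_succ, Complex.ofReal_zero, zero_mul, Complex.exp_zero, ite_self,
    Finset.prod_const_one, one_mul, ← Finset.prod_mul_distrib, couple]
  refine Finset.prod_congr rfl fun j _ => Finset.prod_congr rfl fun t _ => ?_
  have h₁ : Complex.exp (((-(θ j t / 2) : ℝ) : ℂ) * Complex.I) *
      Complex.exp (((θ j t / 2 : ℝ) : ℂ) * Complex.I) = 1 := by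
    rw [← Complex.exp_add, ← Complex.exp_zero]
    congr 1
    push_cast
    ring
  have h₂ : Complex.exp (((θ j t / 2 : ℝ) : ℂ) * Complex.I) *
      Complex.exp (((θ j t / 2 : ℝ) : ℂ) * Complex.I) = Complex.exp (θ j t * Complex.I) := by
    rw [← Complex.exp_add]
    congr 1
    push_cast
    ring
  generalize Complex.exp (((-(θ j t / 2) : ℝ) : ℂ) * Complex.I) = a at h₁ ⊢
  generalize Complex.exp (((θ j t / 2 : ℝ) : ℂ) * Complex.I) = b at h₁ h₂ ⊢
  cases regU x j <;> cases regV x t <;> simp [h₁, h₂]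

/-- After fan-out along rows and columns, every pair of a row bit and a column bit has copies in the
same row, within relay distance, where the phase can be applied. The row and column wirings share
the link cells, which is possible because the row fan-out leaves them zero. The rounds add up as `9
+ 10 + 6 + 4 + 4`. -/
theorem implements_couple_ket {h : ℕ} (hN : N ≤ 2 ^ h) (hk : k ≤ 2 ^ h) (hD : 3 * h ≤ D)
    (θ : Fin (N + 1) → Fin k → ℝ) :
    Implements Cell.Adj D 33 (fun x : {x : Cell N k → Bool // Clear x} => ket x.1)
      (fun x => couple θ (regU x.1) (regV x.1) • ket x.1) := by
  have hr : ∀ x : Cell N k → Bool, Clear x → (rows N k).NodesClear x ∧ (rows N k).LinksClear x :=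
    fun x hx => ⟨fun j i hi => hx.u j i hi, fun j t => hx.l j t⟩
  have hc : ∀ x : Cell N k → Bool, Clear x →
      (columns N k).NodesClear ((rows N k).fan x) ∧ (columns N k).LinksClear ((rows N k).fan x) :=
    fun x hx => ⟨fun t j hj => hx.v j t hj, fun t j => hx.l _ t⟩
  have h₁ := ((rows N k).implements_fan hk hD (implements_rows_join (D := D))).comp
    fun x : {x : Cell N k → Bool // Clear x} => ⟨x.1, hr x.1 x.2⟩
  have h₂ := ((columns N k).implements_fan hN hD (implements_columns_join (D := D))).comp
    fun x : {x : Cell N k → Bool // Clear x} => ⟨(rows N k).fan x.1, hc x.1 x.2⟩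
  have h₃ := implements_conjugated_phase (D := D) isMatching_srcUV adj_srcUV (angle₁ θ) (angle₂ θ)
    fun x : {x : Cell N k → Bool // Clear x} => ket ((columns N k).fan ((rows N k).fan x.1))
  have h₄ := ((columns N k).implements_fan_inverse (adj := Cell.Adj) hN hD).comp
    fun x : {x : Cell N k → Bool // Clear x} => ⟨(rows N k).fan x.1, (hc x.1 x.2).1⟩
  have h₅ := ((rows N k).implements_fan_inverse (adj := Cell.Adj) hk hD).comp
    fun x : {x : Cell N k → Bool // Clear x} => ⟨x.1, (hr x.1 x.2).1⟩
  have h₃' : Implements Cell.Adj D 6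
      (fun x : {x : Cell N k → Bool // Clear x} => ket ((columns N k).fan ((rows N k).fan x.1)))
      (fun x => couple θ (regU x.1) (regV x.1) •
        ket ((columns N k).fan ((rows N k).fan x.1))) := by
    convert h₃ using 2 with x
    funext z
    simp only [Pi.smul_apply, ket, smul_eq_mul, mul_ite, mul_one, mul_zero]
    split_ifs with hz
    · rw [hz, layerPhase_angle θ x.1]
    · rfl
  exact ((h₁.trans h₂).trans h₃').trans ((h₄.trans h₅).smul _)

end Cell


/-- Multiply the amplitude of `|1⟩` by `s`. -/
def twist (s : ℂ) (τ : Bool → ℂ) : Bool → ℂ := fun b => (if b then s else 1) * τ b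

namespace Cell

variable {N k D : ℕ}

/-! ## Product states of the registers -/

/-- The one-qubit factors `σ`, `μ`, `τ` of the three registers, and zeroes elsewhere. -/
def factors (σ μ : Fin (N + 1) → Bool → ℂ) (τ : Fin k → Bool → ℂ) : Cell N k → Bool → ℂ
  | (j, .st) => σ j
  | (j, .u i) => if i = 0 then μ j else bit false
  | (_, .l _) => bit false
  | (j, .v t) => if j = 0 then τ t else bit false

/-- The product state with factors `σ`, `μ`, `τ` on the store, the row register and the column
register, and zeroes elsewhere. -/
def regState (σ μ : Fin (N + 1) → Bool → ℂ) (τ : Fin k → Bool → ℂ) : State (Cell N k) :=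
  productState (factors σ μ τ)

theorem clear_of_regState_ne_zero {σ μ : Fin (N + 1) → Bool → ℂ} {τ : Fin k → Bool → ℂ}
    {x : Cell N k → Bool} (h : regState σ μ τ x ≠ 0) : Clear x := by
  have hq := Finset.prod_ne_zero_iff.1 h
  have hbit : ∀ b, bit false b ≠ 0 → b = false := by
    intro b hb
    cases b
    · rfl
    · simp [bit] at hb
  constructor
  · intro j i hi
    have := hq (j, .u i) (Finset.mem_univ _)
    simp only [factors, hi, if_false] at this
    exact hbit _ this
  · intro j t
    exact hbit _ (hq (j, .l t) (Finset.mem_univ _))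
  · intro j t hj
    have := hq (j, .v t) (Finset.mem_univ _)
    simp only [factors, hj, if_false] at this
    exact hbit _ this

theorem regState_apply (σ μ : Fin (N + 1) → Bool → ℂ) (τ : Fin k → Bool → ℂ)
    {x : Cell N k → Bool} (h : Clear x) : regState σ μ τ x =
      (∏ j, σ j (regS x j)) * ((∏ j, μ j (regU x j)) * ∏ t, τ t (regV x t)) := by
  have h₀ : bit false false = 1 := rfl
  have hu : ∀ j (i : Fin k), x (j, .u i.succ) = false := fun j i => h.u j _ (Fin.succ_ne_zero i)
  have hv : ∀ (j : Fin N) t, x (j.succ, .v t) = false := fun j t => h.v _ t (Fin.succ_ne_zero j)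
  rw [regState, productState, prod_cell]
  congr 1
  congr 1
  · refine Finset.prod_congr rfl fun j _ => ?_
    rw [Fin.prod_univ_succ]
    simp [factors, hu, h₀, Fin.succ_ne_zero, regU]
  · simp only [factors, h.l, h₀, Finset.prod_const_one, one_mul]
    rw [Fin.prod_univ_succ]
    simp [hv, h₀, Fin.succ_ne_zero, regV]

theorem ket_eq_regState {x : Cell N k → Bool} (h : Clear x) : ket x =
    regState (fun j => bit (regS x j)) (fun j => bit (regU x j)) fun t => bit (regV x t) := by
  rw [ket_eq_productState, regState]
  congr 1
  funext ⟨j, c⟩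
  cases c with
  | st => rfl
  | u i =>
    by_cases hi : i = 0
    · subst hi
      rfl
    · simp [factors, hi, h.u j i hi]
  | l t => simp [factors, h.l]
  | v t =>
    by_cases hj : j = 0
    · subst hj
      rfl
    · simp [factors, hj, h.v j t hj]

/-- Gates on the row register and the column register. -/
noncomputable def regGates (A : Fin (N + 1) → Matrix.unitaryGroup Bool ℂ)
    (B : Fin k → Matrix.unitaryGroup Bool ℂ) : Cell N k → Matrix.unitaryGroup Bool ℂ
  | (j, .u i) => if i = 0 then A j else 1
  | (j, .v t) => if j = 0 then B t else 1
  | _ => 1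

theorem act_regGates (A : Fin (N + 1) → Matrix.unitaryGroup Bool ℂ)
    (B : Fin k → Matrix.unitaryGroup Bool ℂ) (σ μ : Fin (N + 1) → Bool → ℂ)
    (τ : Fin k → Bool → ℂ) : (fun q => act (regGates A B q) (factors σ μ τ q)) =
      factors σ (fun j => act (A j) (μ j)) fun t => act (B t) (τ t) := by
  funext ⟨j, c⟩
  cases c with
  | st => simp [regGates, factors]
  | u i => by_cases hi : i = 0 <;> simp [regGates, factors, hi]
  | l t => simp [regGates, factors]
  | v t => by_cases hj : j = 0 <;> simp [regGates, factors, hj]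

section

variable {ι : Type*} (σ μ : ι → Fin (N + 1) → Bool → ℂ) (τ : ι → Fin k → Bool → ℂ)

theorem implements_gates (A : Fin (N + 1) → Matrix.unitaryGroup Bool ℂ)
    (B : Fin k → Matrix.unitaryGroup Bool ℂ) :
    Implements Cell.Adj D 2 (fun i => regState (σ i) (μ i) (τ i))
      (fun i => regState (σ i) (fun j => act (A j) (μ i j)) fun t => act (B t) (τ i t)) := by
  simp only [regState, ← act_regGates]
  exact implements_act _ _

theorem implements_rowGates (A : Fin (N + 1) → Matrix.unitaryGroup Bool ℂ) :
    Implements Cell.Adj D 2 (fun i => regState (σ i) (μ i) (τ i))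
      (fun i => regState (σ i) (fun j => act (A j) (μ i j)) (τ i)) := by
  simpa using implements_gates σ μ τ A 1

theorem implements_columnGates (B : Fin k → Matrix.unitaryGroup Bool ℂ) :
    Implements Cell.Adj D 2 (fun i => regState (σ i) (μ i) (τ i))
      (fun i => regState (σ i) (μ i) fun t => act (B t) (τ i t)) := by
  simpa using implements_gates σ μ τ 1 B

/-- Gates from the row register to the store. -/
def srcUS : Cell N k → Option (Cell N k)
  | (j, .st) => some (j, .u 0)
  | _ => none

/-- Gates from the store to the row register. -/
def srcSU : Cell N k → Option (Cell N k)
  | (j, .u i) => if i = 0 then some (j, .st) else none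
  | _ => none

theorem isMatching_srcUS : IsMatching (srcUS : Cell N k → _) := by
  constructor
  · rintro ⟨j, _ | _ | _ | _⟩ c h <;> simp only [srcUS, reduceCtorEq, Option.some.injEq] at h
    subst h
    rfl
  · rintro ⟨j, _ | _ | _ | _⟩ ⟨j', _ | _ | _ | _⟩ c h h' <;>
      simp only [srcUS, reduceCtorEq, Option.some.injEq] at h h'
    subst h
    simp_all

theorem isMatching_srcSU : IsMatching (srcSU : Cell N k → _) := by
  constructor
  · rintro ⟨j, _ | _ | _ | _⟩ c h <;> simp only [srcSU, reduceCtorEq] at h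
    split_ifs at h
    simp only [Option.some.injEq] at h
    subst h
    rfl
  · rintro ⟨j, _ | _ | _ | _⟩ ⟨j', _ | _ | _ | _⟩ c h h' <;>
      simp only [srcSU, reduceCtorEq] at h h'
    split_ifs at h h'
    simp only [Option.some.injEq] at h h'
    subst h
    simp_all

theorem adj_srcUS (q c : Cell N k) (h : srcUS q = some c) : Cell.Adj c q := by
  obtain ⟨j, _ | _ | _ | _⟩ := q <;> simp only [srcUS, reduceCtorEq, Option.some.injEq] at h
  subst h
  exact Or.inl ⟨rfl, Or.inr rfl⟩

theorem adj_srcSU (q c : Cell N k) (h : srcSU q = some c) : Cell.Adj c q := by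
  obtain ⟨j, _ | _ | _ | _⟩ := q <;> simp only [srcSU, reduceCtorEq] at h
  split_ifs at h with hi
  simp only [Option.some.injEq] at h
  subst h hi
  exact Or.inl ⟨rfl, Or.inl rfl⟩

/-- Three alternating CNOT layers exchange two bits. Parking the data in the store frees the row
register as workspace for the reflection. -/
theorem implements_swap : Implements Cell.Adj D 3 (fun i => regState (σ i) (μ i) (τ i))
    (fun i => regState (μ i) (σ i) (τ i)) := by
  have h := ((implements_cnots (D := D) srcUS isMatching_srcUS adj_srcUS
    fun i => regState (σ i) (μ i) (τ i)).trans
    (implements_cnots srcSU isMatching_srcSU adj_srcSU _)).trans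
    (implements_cnots srcUS isMatching_srcUS adj_srcUS _)
  convert h using 2 with i
  funext x
  set z := flipBy srcUS (flipBy srcSU (flipBy srcUS x)) with hz
  have hzu : ∀ j i, i ≠ 0 → z (j, .u i) = x (j, .u i) := by
    intro j i hi
    simp [hz, flipBy, srcUS, srcSU, hi]
  have hS : regS z = regU x := by
    funext j
    simp only [hz, regS, regU, flipBy, srcUS, srcSU, if_true]
    cases x (j, .st) <;> cases x (j, .u 0) <;> rfl
  have hU : regU z = regS x := by
    funext j
    simp only [hz, regS, regU, flipBy, srcUS, srcSU, if_true]
    cases x (j, .st) <;> cases x (j, .u 0) <;> rfl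
  have hV : regV z = regV x := rfl
  by_cases hx : Clear x
  · have hz' : Clear z := ⟨fun j i hi => by rw [hzu j i hi, hx.u j i hi], hx.l, hx.v⟩
    rw [regState_apply _ _ _ hx, regState_apply _ _ _ hz', hS, hU, hV]
    ring
  · have hz' : ¬ Clear z := fun h =>
      hx ⟨fun j i hi => by rw [← hzu j i hi, h.u j i hi], h.l, h.v⟩
    rw [not_not.1 (mt clear_of_regState_ne_zero hx), not_not.1 (mt clear_of_regState_ne_zero hz')]

variable {h : ℕ} (hN : N ≤ 2 ^ h) (hk : k ≤ 2 ^ h) (hD : 3 * h ≤ D)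
  (θ : Fin (N + 1) → Fin k → ℝ)
include hN hk hD

theorem implements_couple : Implements Cell.Adj D 33 (fun i => regState (σ i) (μ i) (τ i))
    (fun i x => couple θ (regU x) (regV x) * regState (σ i) (μ i) (τ i) x) :=
  (implements_couple_ket hN hk hD θ).diagonal _ fun _ _ h => clear_of_regState_ne_zero h

/-- Phase kickback: for a basis state of the row register, the coupling splits into independent
phases on the column qubits. -/
theorem implements_couple_columns (u : ι → Fin (N + 1) → Bool) :
    Implements Cell.Adj D 33 (fun i => regState (σ i) (fun j => bit (u i j)) (τ i))
      (fun i => regState (σ i) (fun j => bit (u i j)) fun t =>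
        twist (∏ j, if u i j then Complex.exp (θ j t * Complex.I) else 1) (τ i t)) := by
  convert implements_couple σ (fun i j => bit (u i j)) τ hN hk hD θ using 2 with i
  funext x
  by_cases hx : Clear x
  · rw [regState_apply _ _ _ hx, regState_apply _ _ _ hx]
    by_cases hu : regU x = u i
    · rw [couple, Finset.prod_comm, hu]
      simp only [twist, Finset.prod_mul_distrib]
      have : ∀ t, (if regV x t then
          ∏ j, (if u i j then Complex.exp (θ j t * Complex.I) else 1) else 1) =
          ∏ j, if u i j && regV x t then Complex.exp (θ j t * Complex.I) else 1 := by
        intro t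
        cases regV x t <;> simp
      simp only [this]
      ring
    · have : ∏ j, bit (u i j) (regU x j) = 0 := by
        obtain ⟨j, hj⟩ := Function.ne_iff.1 hu
        exact Finset.prod_eq_zero (Finset.mem_univ j) (by simp [bit, hj])
      simp [this]
  · rw [not_not.1 (mt clear_of_regState_ne_zero hx), not_not.1 (mt clear_of_regState_ne_zero hx),
      mul_zero]

theorem implements_couple_rows (v : ι → Fin k → Bool) :
    Implements Cell.Adj D 33 (fun i => regState (σ i) (μ i) (fun t => bit (v i t)))
      (fun i => regState (σ i) (fun j =>
        twist (∏ t, if v i t then Complex.exp (θ j t * Complex.I) else 1) (μ i j))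
          fun t => bit (v i t)) := by
  convert implements_couple σ μ (fun i t => bit (v i t)) hN hk hD θ using 2 with i
  funext x
  by_cases hx : Clear x
  · rw [regState_apply _ _ _ hx, regState_apply _ _ _ hx]
    by_cases hv : regV x = v i
    · rw [couple, hv]
      simp only [twist, Finset.prod_mul_distrib]
      have : ∀ j, (if regU x j then
          ∏ t, (if v i t then Complex.exp (θ j t * Complex.I) else 1) else 1) =
          ∏ t, if regU x j && v i t then Complex.exp (θ j t * Complex.I) else 1 := by
        intro j
        cases regU x j <;> simp
      simp only [this]
      ring
    · have : ∏ t, bit (v i t) (regV x t) = 0 := by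
        obtain ⟨t, ht⟩ := Function.ne_iff.1 hv
        exact Finset.prod_eq_zero (Finset.mem_univ t) (by simp [bit, ht])
      simp [this]
  · rw [not_not.1 (mt clear_of_regState_ne_zero hx), not_not.1 (mt clear_of_regState_ne_zero hx),
      mul_zero]

end

end Cell


/-! ## One-qubit identities -/

/-- The one-qubit state `((1 + z) |0⟩ + (1 - z) |1⟩) / 2`. -/
noncomputable def tilt (z : ℂ) : Bool → ℂ := fun b => (1 + (if b then -1 else 1) * z) / 2

theorem tilt_one : tilt 1 = bit false := by
  funext b
  cases b <;> simp [tilt, bit]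

theorem tilt_neg_one : tilt (-1) = bit true := by
  funext b
  cases b <;> simp [tilt, bit]

/-- With `s = ±1`, the first `twist` between Hadamard gates writes the bit encoded by `s` into the
qubit, the phase gate acts on that bit, and the second half erases it. -/
theorem act_parity (s : ℂ) (hs : s * s = 1) (α : ℝ) :
    act hadamard (twist s (act (hadamard * phaseGate α * hadamard : Matrix.unitaryGroup Bool ℂ)
      (twist s (act hadamard (bit false))))) =
      ((1 + s) / 2 + (1 - s) / 2 * Complex.exp (α * Complex.I)) • bit false := by
  have hr : rsqrt2 ^ 4 = 1 / 4 := by linear_combination (rsqrt2 * rsqrt2 + 1 / 2) * rsqrt2_mul_self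
  simp only [Submonoid.coe_mul, act_mul]
  funext b
  cases b <;>
    simp only [act_hadamard, act_phaseGate, twist, bit, Pi.smul_apply, smul_eq_mul, if_true,
      Bool.false_eq_true, if_false, reduceCtorEq]
  · linear_combination ((1 + s) ^ 2 + Complex.exp (α * Complex.I) * (1 - s) ^ 2) * hr +
      1 / 4 * (1 + Complex.exp (α * Complex.I)) * hs
  · linear_combination (-rsqrt2 ^ 4 * (1 + Complex.exp (α * Complex.I))) * hs

theorem act_tilt (s : ℂ) (α : ℝ) :
    act (hadamard * phaseGate α : Matrix.unitaryGroup Bool ℂ)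
      (twist s (act hadamard (bit false))) = tilt (Complex.exp (α * Complex.I) * s) := by
  have hr := rsqrt2_mul_self
  simp only [Submonoid.coe_mul, act_mul]
  funext b
  cases b <;>
    simp only [act_hadamard, act_phaseGate, twist, tilt, bit, if_true, Bool.false_eq_true, if_false,
      reduceCtorEq]
  · linear_combination (1 + Complex.exp (α * Complex.I) * s) * hr
  · linear_combination (1 - Complex.exp (α * Complex.I) * s) * hr

theorem act_untilt (z s : ℂ) (α : ℝ) (h : s * Complex.exp (α * Complex.I) * z = 1) :
    act hadamard (twist s (act (phaseGate α * hadamard : Matrix.unitaryGroup Bool ℂ)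
      (tilt z))) = bit false := by
  have hr := rsqrt2_mul_self
  simp only [Submonoid.coe_mul, act_mul]
  funext b
  cases b <;>
    simp only [act_hadamard, act_phaseGate, twist, tilt, bit, if_true, Bool.false_eq_true, if_false,
      reduceCtorEq]
  · linear_combination 2 * hr + rsqrt2 * rsqrt2 * h
  · linear_combination -(rsqrt2 * rsqrt2) * h

/-! ## The reflection about the zero state of the column register -/

/-- The sign `(-1)^{S · v}`. -/
def parSign {k : ℕ} (S v : Fin k → Bool) : ℂ := ∏ t, if S t && v t then -1 else 1

theorem parSign_mul_self {k : ℕ} (S v : Fin k → Bool) : parSign S v * parSign S v = 1 := by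
  rw [parSign, ← Finset.prod_mul_distrib]
  refine Finset.prod_eq_one fun t _ => ?_
  split_ifs <;> norm_num

/-- The phase `e^{iα}` if `S · v` is odd. -/
noncomputable def parPhase {k : ℕ} (α : ℝ) (S v : Fin k → Bool) : ℂ :=
  (1 + parSign S v) / 2 + (1 - parSign S v) / 2 * Complex.exp (α * Complex.I)

theorem parPhase_zero {k : ℕ} (S v : Fin k → Bool) : parPhase 0 S v = 1 := by
  rw [parPhase, Complex.ofReal_zero, zero_mul, Complex.exp_zero]
  ring

/-- `1` on the zero string and `-1` on all others. -/
def zeroSign {k : ℕ} (v : Fin k → Bool) : ℂ := if v = fun _ => false then 1 else -1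

/-- For nonzero `v`, the strings `S` come in pairs differing at a position `t₀` where `v` is one.
Exactly one member of each pair has odd parity, and the `2 ^ (k - 1)` pairs contribute the total
angle `π`. -/
theorem prod_parPhase {k : ℕ} (v : Fin k → Bool) :
    ∏ S, parPhase (Real.pi / 2 ^ (k - 1)) S v = zeroSign v := by
  set α : ℝ := Real.pi / 2 ^ (k - 1) with hα
  by_cases hv : v = fun _ => false
  · rw [zeroSign, if_pos hv]
    refine Finset.prod_eq_one fun S _ => ?_
    simp [parPhase, parSign, hv]
  · rw [zeroSign, if_neg hv]
    obtain ⟨t₀, ht₀⟩ := Function.ne_iff.1 hv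
    rw [Bool.ne_false_iff] at ht₀
    -- Splitting off the coordinate `t₀` realises the pairing of the strings `S`.
    rw [← (Equiv.funSplitAt t₀ Bool).symm.prod_comp, Fintype.prod_prod_type, Fintype.prod_bool,
      ← Finset.prod_mul_distrib]
    have key : ∀ r : {t // t ≠ t₀} → Bool,
        parPhase α ((Equiv.funSplitAt t₀ Bool).symm (true, r)) v *
          parPhase α ((Equiv.funSplitAt t₀ Bool).symm (false, r)) v =
          Complex.exp (α * Complex.I) := by
      intro r
      have hs : parSign ((Equiv.funSplitAt t₀ Bool).symm (true, r)) v =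
          - parSign ((Equiv.funSplitAt t₀ Bool).symm (false, r)) v := by
        rw [parSign, parSign, ← Finset.mul_prod_erase _ _ (Finset.mem_univ t₀),
          ← Finset.mul_prod_erase _ _ (Finset.mem_univ t₀)]
        have : ∀ t ∈ Finset.univ.erase t₀,
            (if (Equiv.funSplitAt t₀ Bool).symm (true, r) t && v t then (-1 : ℂ) else 1) =
            if (Equiv.funSplitAt t₀ Bool).symm (false, r) t && v t then -1 else 1 := by
          intro t ht
          simp [Equiv.funSplitAt, Equiv.piSplitAt, Finset.ne_of_mem_erase ht]
        rw [Finset.prod_congr rfl this]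
        simp [Equiv.funSplitAt, Equiv.piSplitAt, ht₀]
      have hq := parSign_mul_self ((Equiv.funSplitAt t₀ Bool).symm (false, r)) v
      rw [parPhase, parPhase, hs]
      set s := parSign ((Equiv.funSplitAt t₀ Bool).symm (false, r)) v
      linear_combination (-(1 / 4) * (1 - Complex.exp (α * Complex.I)) ^ 2) * hq
    rw [Finset.prod_congr rfl fun r _ => key r, Finset.prod_const, Finset.card_univ]
    have hcard : Fintype.card ({t // t ≠ t₀} → Bool) = 2 ^ (k - 1) := by
      simp [Fintype.card_subtype_compl]
    rw [hcard, ← Complex.exp_nat_mul, ← Complex.exp_pi_mul_I]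
    congr 1
    rw [hα]
    push_cast
    field_simp

namespace Cell

variable {N k D h : ℕ} (hN : N ≤ 2 ^ h) (hk : k ≤ 2 ^ h) (hD : 3 * h ≤ D)

theorem regState_smul_right (σ μ : Fin (N + 1) → Bool → ℂ) (τ : Fin k → Bool → ℂ)
    (c : Fin (N + 1) → ℂ) :
    regState σ (fun j => c j • μ j) τ = (∏ j, c j) • regState σ μ τ := by
  funext x
  by_cases hx : Clear x
  · rw [Pi.smul_apply, regState_apply _ _ _ hx, regState_apply _ _ _ hx]
    simp only [Pi.smul_apply, smul_eq_mul, Finset.prod_mul_distrib]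
    ring
  · rw [Pi.smul_apply, not_not.1 (mt clear_of_regState_ne_zero hx),
      not_not.1 (mt clear_of_regState_ne_zero hx), smul_zero]

include hN hk hD

/-- Angles `0` and `π` make the coupling apply the sign of `S j` and `v` to row qubit `j`, so all
rows evaluate their parities simultaneously. -/
theorem implements_parPhase {ι : Type*} (σ : ι → Fin (N + 1) → Bool → ℂ) (v : ι → Fin k → Bool)
    (S : Fin (N + 1) → Fin k → Bool) (α : Fin (N + 1) → ℝ) :
    Implements Cell.Adj D 72
      (fun i => regState (σ i) (fun _ => bit false) fun t => bit (v i t))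
      (fun i => (∏ j, parPhase (α j) (S j) (v i)) •
        regState (σ i) (fun _ => bit false) fun t => bit (v i t)) := by
  set θ : Fin (N + 1) → Fin k → ℝ := fun j t => if S j t then Real.pi else 0 with hθ
  have hsign : ∀ i j, (∏ t, if v i t then Complex.exp (θ j t * Complex.I) else 1) =
      parSign (S j) (v i) := by
    intro i j
    refine Finset.prod_congr rfl fun t _ => ?_
    simp only [hθ]
    cases S j t <;> cases v i t <;> simp [Complex.exp_pi_mul_I]
  have h := ((((implements_rowGates (D := D) σ (fun _ _ => bit false) (fun i t => bit (v i t))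
    (fun _ => hadamard)).trans
    (implements_couple_rows σ _ hN hk hD θ v)).trans
    (implements_rowGates σ _ (fun i t => bit (v i t))
      (fun j => hadamard * phaseGate (α j) * hadamard))).trans
    (implements_couple_rows σ _ hN hk hD θ v)).trans
    (implements_rowGates σ _ (fun i t => bit (v i t)) (fun _ => hadamard))
  refine h.of_eq_smul 1 fun i => ?_
  simp only [hsign, act_parity _ (parSign_mul_self _ _)]
  rw [one_smul, ← regState_smul_right]
  rfl

theorem implements_reflection_bits {ι : Type*} (hkN : 2 ^ k ≤ 2 * (N + 1))
    (σ : ι → Fin (N + 1) → Bool → ℂ) (v : ι → Fin k → Bool) :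
    Implements Cell.Adj D 144
      (fun i => regState (σ i) (fun _ => bit false) fun t => bit (v i t))
      (fun i => zeroSign (v i) •
        regState (σ i) (fun _ => bit false) fun t => bit (v i t)) := by
  obtain ⟨e⟩ : Nonempty ((Fin k → Bool) ↪ Bool × Fin (N + 1)) :=
    Function.Embedding.nonempty_of_card_le (by simpa using hkN)
  -- Each string gets a slot, given by a pass and a row. Slots not used by `e` carry the angle zero
  -- and contribute the factor one.
  set S : Bool × Fin (N + 1) → Fin k → Bool := Function.extend e id fun _ _ => false with hS
  set α : Bool × Fin (N + 1) → ℝ :=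
    Function.extend e (fun _ => Real.pi / 2 ^ (k - 1)) fun _ => 0 with hα
  have h := (implements_parPhase hN hk hD σ v (fun j => S (true, j)) fun j => α (true, j)).trans
    ((implements_parPhase hN hk hD σ v (fun j => S (false, j)) fun j => α (false, j)).smul _)
  refine h.of_eq_smul 1 fun i => ?_
  rw [one_smul, smul_smul]
  congr 1
  rw [← prod_parPhase, Fintype.prod_of_injective e e.injective _
    (fun p => parPhase (α p) (S p) (v i)), Fintype.prod_prod_type, Fintype.prod_bool]
  · intro p hp
    rw [hα, Function.extend_apply' _ _ _ hp, parPhase_zero]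
  · intro T
    rw [hα, hS, e.injective.extend_apply, e.injective.extend_apply, id]

theorem implements_reflection {ι : Type*} (hkN : 2 ^ k ≤ 2 * (N + 1))
    (σ : ι → Fin (N + 1) → Bool → ℂ) (τ : ι → Fin k → Bool → ℂ) :
    Implements Cell.Adj D 144
      (fun i => regState (σ i) (fun _ => bit false) (τ i))
      (fun i x => zeroSign (regV x) * regState (σ i) (fun _ => bit false) (τ i) x) := by
  have h := implements_reflection_bits hN hk hD hkN
    (fun x : {x : Cell N k → Bool // Clear x ∧ ∀ j, regU x j = false} => fun j => bit (regS x.1 j))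
    (fun x => regV x.1)
  have hket : ∀ x : {x : Cell N k → Bool // Clear x ∧ ∀ j, regU x j = false},
      regState (fun j => bit (regS x.1 j)) (fun _ => bit false) (fun t => bit (regV x.1 t)) =
        ket x.1 := by
    rintro ⟨x, hx, hu⟩
    rw [ket_eq_regState hx]
    simp only [hu]
  simp only [hket] at h
  refine Implements.diagonal (d := fun x => zeroSign (regV x)) h _ fun i x hx => ?_
  have hc := clear_of_regState_ne_zero hx
  refine ⟨hc, fun j => ?_⟩
  rw [regState_apply _ _ _ hc] at hx
  have := Finset.prod_ne_zero_iff.1 (left_ne_zero_of_mul (right_ne_zero_of_mul hx)) j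
    (Finset.mem_univ j)
  by_contra hne
  exact this (by simp [bit, hne])

end Cell

/-! ## Sign flips that depend on the Hamming weight -/

/-- The Hamming weight. -/
def weight {n : ℕ} (u : Fin n → Bool) : ℕ := (Finset.univ.filter fun j => u j = true).card

/-- `1` on strings of weight `c` and `-1` on all others. -/
def weightSign {n : ℕ} (c : ℕ) (u : Fin n → Bool) : ℂ := if weight u = c then 1 else -1

/-- Here `t` is the 2-adic valuation of `d`, bounded by `k` because `2 ^ t ≤ |d|`. -/
theorem exists_odd_multiple {d : ℤ} {k : ℕ} (hd : d ≠ 0) (hk : d.natAbs < 2 ^ k) :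
    ∃ t < k, ∃ m : ℤ, Odd m ∧ d = 2 ^ t * m := by
  obtain ⟨t, m, hm, hdm⟩ := Nat.exists_eq_two_pow_mul_odd (Int.natAbs_ne_zero.2 hd)
  have ht : 2 ^ t ≤ d.natAbs := hdm ▸ Nat.le_mul_of_pos_right _ hm.pos
  refine ⟨t, (Nat.pow_lt_pow_iff_right (by norm_num)).1 (ht.trans_lt hk), ?_⟩
  rcases Int.natAbs_eq d with h | h
  · exact ⟨m, by exact_mod_cast hm, by rw [h, hdm]; push_cast; ring⟩
  · exact ⟨-m, (by exact_mod_cast hm : Odd (m : ℤ)).neg, by rw [h, hdm]; push_cast; ring⟩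

/-- The eigenvalue of the rotation by `π / 2 ^ t` per unit of weight in excess of `c`. -/
noncomputable def kick {n : ℕ} (c : ℕ) (u : Fin n → Bool) (t : ℕ) : ℂ :=
  Complex.exp ((-(c * (Real.pi / 2 ^ t)) : ℝ) * Complex.I) *
    Complex.exp ((Real.pi / 2 ^ t : ℝ) * Complex.I) ^ weight u

theorem kick_eq {n : ℕ} (c : ℕ) (u : Fin n → Bool) (t : ℕ) :
    kick c u t = Complex.exp (((weight u : ℤ) - c : ℤ) * (Real.pi / 2 ^ t * Complex.I)) := by
  rw [kick, ← Complex.exp_nat_mul, ← Complex.exp_add]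
  congr 1
  push_cast
  ring

theorem kick_eq_one {n : ℕ} {c : ℕ} {u : Fin n → Bool} (hu : weight u = c) (t : ℕ) :
    kick c u t = 1 := by
  rw [kick_eq, hu]
  simp

/-- At the 2-adic valuation `t` of `weight u - c`, the accumulated angle is an odd multiple of `π`.
-/
theorem exists_kick_eq_neg_one {n c k : ℕ} {u : Fin n → Bool} (hu : weight u ≠ c)
    (hn : n < 2 ^ k) (hc : c < 2 ^ k) : ∃ t : Fin k, kick c u t = -1 := by
  have hw : weight u ≤ n := (Finset.card_filter_le _ _).trans (by simp)
  obtain ⟨t, ht, m, hm, hd⟩ := exists_odd_multiple (d := (weight u : ℤ) - c) (k := k)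
    (by omega) (by
      have h2 : ((2 ^ k : ℕ) : ℤ) = (2 ^ k : ℕ) := rfl
      generalize 2 ^ k = K at hn hc ⊢
      omega)
  refine ⟨⟨t, ht⟩, ?_⟩
  rw [kick_eq, hd]
  have : (((2 ^ t * m : ℤ) : ℂ)) * (Real.pi / 2 ^ t * Complex.I) = m * (Real.pi * Complex.I) := by
    push_cast
    field_simp
  rw [this, Complex.exp_int_mul, Complex.exp_pi_mul_I, hm.neg_one_zpow]

namespace Cell

variable {N k D h : ℕ} (hN : N ≤ 2 ^ h) (hk : k ≤ 2 ^ h) (hD : 3 * h ≤ D)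

/-- The basis state `u` of the row register, with zeroes elsewhere. -/
def rowKet (u : Fin (N + 1) → Bool) : State (Cell N k) :=
  regState (fun _ => bit false) (fun j => bit (u j)) fun _ => bit false

/-- At the right weight the column register is exactly the zero string. At any other weight some
column qubit is exactly `|1⟩`, so the zero string has amplitude zero even if the remaining qubits
are in superposition. Hence the reflection acts as a scalar. -/
theorem zeroSign_mul_regState (hkN : N + 1 < 2 ^ k) {c : ℕ} (hc : c ≤ 1)
    (u : Fin (N + 1) → Bool) (σ μ : Fin (N + 1) → Bool → ℂ) :
    (fun x : Cell N k → Bool =>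
      zeroSign (regV x) * regState σ μ (fun t : Fin k => tilt (kick c u t)) x) =
      weightSign c u • regState σ μ fun t : Fin k => tilt (kick c u t) := by
  funext x
  rw [Pi.smul_apply, smul_eq_mul]
  by_cases h0 : regState σ μ (fun t : Fin k => tilt (kick c u t)) x = 0
  · rw [h0, mul_zero, mul_zero]
  congr 1
  have hx := clear_of_regState_ne_zero h0
  rw [regState_apply _ _ _ hx] at h0
  have hτ := Finset.prod_ne_zero_iff.1 (right_ne_zero_of_mul (right_ne_zero_of_mul h0))
  by_cases hu : weight u = c
  · rw [weightSign, if_pos hu, zeroSign, if_pos]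
    funext t
    have := hτ t (Finset.mem_univ t)
    rw [kick_eq_one hu, tilt_one] at this
    by_contra hne
    exact this (by simp [bit, hne])
  · rw [weightSign, if_neg hu, zeroSign, if_neg]
    intro hv
    obtain ⟨t, ht⟩ := exists_kick_eq_neg_one hu hkN (by omega)
    have := hτ t (Finset.mem_univ t)
    rw [ht, tilt_neg_one, hv] at this
    exact this (by simp [bit])

include hN hk hD

/-- Compute the kickback, park the data in the store, reflect, bring the data back, uncompute. The
bound `2 ^ k ≤ 2 * (N + 1)` lets two passes over the rows suffice; `N + 1 < 2 ^ k` gives enough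
column qubits to detect every weight difference. -/
theorem implements_weightSign (hkN : 2 ^ k ≤ 2 * (N + 1)) (hNk : N + 1 < 2 ^ k) {c : ℕ}
    (hc : c ≤ 1) : Implements Cell.Adj D 224 (fun u => (rowKet u : State (Cell N k)))
      (fun u => weightSign c u • rowKet u) := by
  set θ : Fin (N + 1) → Fin k → ℝ := fun _ t => Real.pi / 2 ^ (t : ℕ) with hθ
  have hprod : ∀ (u : Fin (N + 1) → Bool) (a : ℂ), (∏ j, if u j then a else 1) = a ^ weight u := by
    intro u a
    rw [Finset.prod_ite, Finset.prod_const, Finset.prod_const_one, mul_one, weight]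
  have h₁ := ((implements_columnGates (D := D) (fun _ _ => bit false)
    (fun (u : Fin (N + 1) → Bool) j => bit (u j)) (fun _ (_ : Fin k) => bit false)
    (fun _ => hadamard)).trans
    (implements_couple_columns (fun _ _ => bit false) _ hN hk hD θ fun u => u)).trans
    (implements_columnGates (fun _ _ => bit false) (fun (u : Fin (N + 1) → Bool) j => bit (u j)) _
      (fun t => hadamard * phaseGate (-(c * (Real.pi / 2 ^ (t : ℕ))))))
  have h₂ : Implements Cell.Adj D 37 (fun u => (rowKet u : State (Cell N k))) (fun u =>
      regState (fun _ => bit false) (fun j => bit (u j)) fun t => tilt (kick c u t)) := by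
    refine h₁.of_eq_smul 1 fun u => ?_
    rw [one_smul]
    simp only [hθ, hprod, act_tilt]
    rfl
  have h₃ : Implements Cell.Adj D 144
      (fun u : Fin (N + 1) → Bool => regState (fun j => bit (u j)) (fun _ => bit false)
        fun t : Fin k => tilt (kick c u t))
      (fun u => weightSign c u • regState (fun j => bit (u j)) (fun _ => bit false)
        fun t : Fin k => tilt (kick c u t)) := by
    have := implements_reflection hN hk hD hkN (fun (u : Fin (N + 1) → Bool) j => bit (u j))
      fun u (t : Fin k) => tilt (kick c u t)
    convert this using 2 with u
    exact (zeroSign_mul_regState hNk hc u _ _).symm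
  have h₅ := ((implements_columnGates (D := D) (fun _ _ => bit false)
    (fun (u : Fin (N + 1) → Bool) j => bit (u j)) (fun u (t : Fin k) => tilt (kick c u t))
    (fun t => phaseGate (c * (Real.pi / 2 ^ (t : ℕ))) * hadamard)).trans
    (implements_couple_columns (fun _ _ => bit false) _ hN hk hD
      (fun j t => -θ j t) fun u => u)).trans
    (implements_columnGates (fun _ _ => bit false)
    (fun (u : Fin (N + 1) → Bool) j => bit (u j)) _ (fun _ => hadamard))
  have h₆ : Implements Cell.Adj D 37 (fun u => regState (fun _ => bit false)
      (fun j => bit (u j)) fun t => tilt (kick c u t)) (fun u => (rowKet u : State (Cell N k))) := by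
    refine h₅.of_eq_smul 1 fun u => ?_
    rw [one_smul]
    congr 1
    · funext t
      simp only [hθ, hprod]
      refine act_untilt _ _ _ ?_
      simp only [kick]
      have e₁ : Complex.exp (((-(Real.pi / 2 ^ (t : ℕ)) : ℝ) : ℂ) * Complex.I) *
          Complex.exp (((Real.pi / 2 ^ (t : ℕ) : ℝ) : ℂ) * Complex.I) = 1 := by
        rw [← Complex.exp_add, ← Complex.exp_zero]
        congr 1
        push_cast
        ring
      have e₂ : Complex.exp (((c * (Real.pi / 2 ^ (t : ℕ)) : ℝ) : ℂ) * Complex.I) *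
          Complex.exp (((-(c * (Real.pi / 2 ^ (t : ℕ))) : ℝ) : ℂ) * Complex.I) = 1 := by
        rw [← Complex.exp_add, ← Complex.exp_zero]
        congr 1
        push_cast
        ring
      calc _ = (Complex.exp (((-(Real.pi / 2 ^ (t : ℕ)) : ℝ) : ℂ) * Complex.I) *
            Complex.exp (((Real.pi / 2 ^ (t : ℕ) : ℝ) : ℂ) * Complex.I)) ^ weight u *
          (Complex.exp (((c * (Real.pi / 2 ^ (t : ℕ)) : ℝ) : ℂ) * Complex.I) *
          Complex.exp (((-(c * (Real.pi / 2 ^ (t : ℕ))) : ℝ) : ℂ) * Complex.I)) := by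
            rw [mul_pow]
            ring
        _ = 1 := by rw [e₁, e₂, one_pow, one_mul]
  have h₄ := ((h₂.trans (implements_swap _ _ _)).trans h₃).trans
    ((implements_swap (fun (u : Fin (N + 1) → Bool) j => bit (u j)) (fun _ _ => bit false)
      fun u (t : Fin k) => tilt (kick c u t)).smul fun u => weightSign c u)
  exact h₄.trans (h₆.smul _)

end Cell


/-! ## Amplitude amplification -/

theorem weight_eq_zero {n : ℕ} {u : Fin n → Bool} : weight u = 0 ↔ u = fun _ => false := by
  simp [weight, Finset.card_eq_zero, Finset.filter_eq_empty_iff, funext_iff]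

theorem weight_eq_one {n : ℕ} {u : Fin n → Bool} : weight u = 1 ↔ ∃ i, u = oneHot i := by
  rw [weight, Finset.card_eq_one]
  refine exists_congr fun i => ?_
  simp only [Finset.ext_iff, Finset.mem_filter, Finset.mem_univ, true_and, Finset.mem_singleton,
    funext_iff, oneHot]
  refine forall_congr' fun j => ?_
  cases u j <;> simp

theorem oneHot_injective {n : ℕ} : Function.Injective (oneHot : Fin n → Fin n → Bool) := by
  intro i j h
  have := congrFun h i
  simpa [oneHot] using this

theorem exists_rotation {n : ℕ} (hn : 1 ≤ n) :
    ∃ β : ℝ, n * (Real.sin β * Real.cos β ^ (n - 1)) ^ 2 = 1 / 4 := by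
  set f : ℝ → ℝ := fun β => n * (Real.sin β * Real.cos β ^ (n - 1)) ^ 2 with hf
  have hn' : (1 : ℝ) ≤ n := by exact_mod_cast hn
  -- At `sin² γ = p`, Bernoulli's inequality gives `n p (1 - p)^(n - 1) ≥ 1/2 * 1/2`, so the value
  -- `1/4` is attained between `0` and `γ`.
  set p : ℝ := 1 / (2 * n) with hp
  have hnp : (n : ℝ) * p = 1 / 2 := by
    rw [hp]
    field_simp
  have hp0 : 0 ≤ p := by positivity
  have hp1 : p ≤ 1 / 2 := by nlinarith
  have hs1 : Real.sqrt p ≤ 1 := Real.sqrt_le_one.2 (by linarith)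
  set γ := Real.arcsin (Real.sqrt p) with hγ
  have hsin : Real.sin γ = Real.sqrt p :=
    Real.sin_arcsin (by linarith [Real.sqrt_nonneg p]) hs1
  have hsin2 : Real.sin γ ^ 2 = p := by rw [hsin, Real.sq_sqrt hp0]
  have hcos2 : Real.cos γ ^ 2 = 1 - p := by rw [Real.cos_sq', hsin2]
  have hγ0 : 0 ≤ γ := Real.arcsin_nonneg.2 (Real.sqrt_nonneg p)
  have hcont : ContinuousOn f (Set.Icc 0 γ) := by
    refine Continuous.continuousOn ?_
    fun_prop
  have h0 : f 0 = 0 := by simp [hf]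
  have h1 : 1 / 4 ≤ f γ := by
    have hb := one_add_mul_le_pow (a := -p) (by linarith) (n - 1)
    have hcast : ((n - 1 : ℕ) : ℝ) = n - 1 := by
      rw [Nat.cast_sub hn, Nat.cast_one]
    rw [hcast] at hb
    have hb' : 1 / 2 ≤ (1 - p) ^ (n - 1) := by
      rw [sub_eq_add_neg]
      nlinarith
    have : f γ = (n * p) * (1 - p) ^ (n - 1) := by
      simp only [hf]
      rw [mul_pow, hsin2, ← hcos2, ← pow_mul, ← pow_mul, mul_comm 2, mul_assoc]
    rw [this, hnp]
    linarith
  obtain ⟨β, -, hβ⟩ := intermediate_value_Icc hγ0 hcont ⟨by rw [h0]; norm_num, h1⟩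
  exact ⟨β, hβ⟩

section Grover

variable {n : ℕ} (β : ℝ)

/-- The rotation by `β` of every qubit. -/
noncomputable def rotate (β : ℝ) : State (Fin n) → State (Fin n) :=
  tensor fun _ => (rotation β : Matrix Bool Bool ℂ)

theorem act_rotation_neg (τ : Bool → ℂ) : act (rotation β) (act (rotation (-β)) τ) = τ := by
  have h : (Real.cos β : ℂ) ^ 2 + (Real.sin β : ℂ) ^ 2 = 1 := by
    exact_mod_cast Real.cos_sq_add_sin_sq β
  funext a
  cases a <;>
    simp only [act, rotation_apply, Fintype.sum_bool, Real.cos_neg, Real.sin_neg,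
      Complex.ofReal_neg, if_true, if_false, reduceCtorEq, Bool.false_eq_true, neg_neg]
  · linear_combination (τ false) * h
  · linear_combination (τ true) * h

theorem rotate_rotate_neg (f : State (Fin n)) : rotate β (rotate (-β) f) = f := by
  have hid : IsLinearMap ℂ fun f : State (Fin n) => f := ⟨fun _ _ => rfl, fun _ _ => rfl⟩
  have hc : IsLinearMap ℂ fun f : State (Fin n) => rotate β (rotate (-β) f) :=
    ⟨fun f g => by
      rw [rotate, rotate, (isLinearMap_tensor _).map_add, (isLinearMap_tensor _).map_add],
      fun c f => by
      rw [rotate, rotate, (isLinearMap_tensor _).map_smul, (isLinearMap_tensor _).map_smul]⟩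
  refine congrFun (isLinearMap_ext hc hid fun y => ?_) f
  simp only [rotate, ket_eq_productState, tensor_productState, act_rotation_neg]

theorem rotate_neg_rotate (f : State (Fin n)) : rotate (-β) (rotate β f) = f := by
  simpa using rotate_rotate_neg (-β) f

theorem prod_oneHot (i : Fin n) (a b : ℂ) :
    (∏ j, if oneHot i j then a else b) = a * b ^ (n - 1) := by
  rw [← Finset.mul_prod_erase _ _ (Finset.mem_univ i)]
  congr 1
  · simp [oneHot]
  · rw [Finset.prod_congr rfl (g := fun _ => b), Finset.prod_const,
      Finset.card_erase_of_mem (Finset.mem_univ i), Finset.card_univ, Fintype.card_fin]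
    intro j hj
    simp [oneHot, Finset.ne_of_mem_erase hj]

theorem rotate_zero_oneHot (i : Fin n) :
    rotate β (ket fun _ => false) (oneHot i) = (Real.sin β * Real.cos β ^ (n - 1) : ℝ) := by
  rw [rotate, ket_eq_productState, tensor_productState]
  simp only [productState, act_bit, rotation_apply]
  push_cast
  rw [← prod_oneHot i]
  refine Finset.prod_congr rfl fun j _ => ?_
  cases oneHot i j <;> simp

theorem rotate_neg_oneHot (i : Fin n) :
    rotate (-β) (ket (oneHot i)) (fun _ => false) = (Real.sin β * Real.cos β ^ (n - 1) : ℝ) := by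
  rw [rotate, ket_eq_productState, tensor_productState]
  simp only [productState, act_bit, rotation_apply]
  push_cast
  rw [← prod_oneHot i]
  refine Finset.prod_congr rfl fun j _ => ?_
  cases oneHot i j <;> simp

/-- Let `ψ` be the rotated zero state and `χ` its weight-one part. The first sign flip yields `2χ -
ψ`, whose overlap with `ψ` is `2/4 - 1 = -1/2`. Reflecting about `ψ` then gives `-ψ - (2χ - ψ) =
-2χ`, in which the unwanted part has cancelled. -/
theorem amplify (hn : 1 ≤ n) (hβ : n * (Real.sin β * Real.cos β ^ (n - 1)) ^ 2 = 1 / 4) :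
    ∃ c : ℂ, rotate β (fun u => weightSign 0 u * rotate (-β) (fun u => weightSign 1 u *
      rotate β (ket fun _ => false) u) u) = c • wState n := by
  set a : ℂ := ((Real.sin β * Real.cos β ^ (n - 1) : ℝ) : ℂ) with ha
  have ha2 : (n : ℂ) * (a * a) = 1 / 4 := by
    rw [ha, ← sq]
    have := congrArg (fun r : ℝ => (r : ℂ)) hβ
    push_cast at this ⊢
    exact this
  have hlin : ∀ γ : ℝ, IsLinearMap ℂ (rotate γ : State (Fin n) → _) :=
    fun γ => isLinearMap_tensor _
  set ψ : State (Fin n) := rotate β (ket fun _ => false) with hψ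
  set χ : State (Fin n) := ∑ i, a • ket (oneHot i) with hχ
  have hχ_apply : ∀ u, χ u = if weight u = 1 then ψ u else 0 := by
    intro u
    simp only [hχ, Finset.sum_apply, Pi.smul_apply, ket, smul_eq_mul, mul_ite, mul_one, mul_zero]
    split_ifs with hu
    · obtain ⟨i, rfl⟩ := weight_eq_one.1 hu
      rw [hψ, rotate_zero_oneHot, Finset.sum_eq_single i]
      · rw [if_pos rfl]
      · intro j _ hj
        rw [if_neg fun h => hj (oneHot_injective h).symm]
      · simp
    · refine Finset.sum_eq_zero fun i _ => ?_
      rw [if_neg fun h => hu (weight_eq_one.2 ⟨i, h⟩)]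
  have h₁ : (fun u => weightSign 1 u * ψ u) = (2 : ℂ) • χ + (-1 : ℂ) • ψ := by
    funext u
    rw [Pi.add_apply, Pi.smul_apply, Pi.smul_apply, hχ_apply, weightSign]
    split_ifs
    · simp only [smul_eq_mul]
      ring
    · simp
  set φ := rotate (-β) (fun u => weightSign 1 u * ψ u) with hφ
  have hχ0 : rotate (-β) χ (fun _ => false) = 1 / 4 := by
    rw [hχ, ← (hlin _).mk'_apply, map_sum, Finset.sum_apply]
    simp only [map_smul, IsLinearMap.mk'_apply, Pi.smul_apply, rotate_neg_oneHot, smul_eq_mul,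
      Finset.sum_const, Finset.card_univ, Fintype.card_fin, nsmul_eq_mul, ← ha, ha2]
  have hψ0 : rotate (-β) ψ (fun _ => false) = 1 := by
    rw [hψ, rotate_neg_rotate]
    simp [ket]
  have hφ0 : φ (fun _ => false) = -1 / 2 := by
    rw [hφ, h₁, (hlin _).map_add, (hlin _).map_smul, (hlin _).map_smul, Pi.add_apply,
      Pi.smul_apply, Pi.smul_apply, hχ0, hψ0]
    simp only [smul_eq_mul]
    norm_num
  have h₀ : (fun u => weightSign 0 u * φ u) = (-1 : ℂ) • (ket fun _ => false) + (-1 : ℂ) • φ := by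
    funext u
    rw [Pi.add_apply, Pi.smul_apply, Pi.smul_apply, weightSign, ket]
    by_cases hu : u = fun _ => false
    · rw [if_pos (weight_eq_zero.2 hu), if_pos hu, hu, hφ0]
      simp only [smul_eq_mul]
      norm_num
    · rw [if_neg (mt weight_eq_zero.1 hu), if_neg hu]
      simp
  have hn0 : (Real.sqrt n : ℂ) ≠ 0 := by
    rw [Complex.ofReal_ne_zero]
    have : (0 : ℝ) < n := by exact_mod_cast hn
    positivity
  -- The result is `-2χ`, and `χ` is `a √n` times the W state.
  refine ⟨-2 * a * Real.sqrt n, ?_⟩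
  rw [h₀, (hlin _).map_add, (hlin _).map_smul, (hlin _).map_smul, ← hψ, hφ, rotate_rotate_neg, h₁]
  funext u
  simp only [Pi.add_apply, Pi.smul_apply, smul_eq_mul, hχ, wState, Finset.sum_apply,
    ← Finset.mul_sum]
  field_simp
  ring

end Grover

theorem eq_of_bit_ne_zero {a b : Bool} (h : bit b a ≠ 0) : a = b := by
  by_contra hne
  exact h (if_neg hne)

/-! ### Amplitude amplification carried out on the row register. -/

namespace Cell

variable {N k D h : ℕ}

/-- The basis state of all qubits that is `u` on the row register and zero elsewhere. -/
def rowString (u : Fin (N + 1) → Bool) : Cell N k → Bool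
  | (j, .u i) => if i = 0 then u j else false
  | _ => false

theorem clear_rowString (u : Fin (N + 1) → Bool) : Clear (rowString u : Cell N k → Bool) :=
  ⟨fun j i hi => by simp [rowString, hi], fun _ _ => rfl, fun _ _ _ => rfl⟩

theorem rowString_injective : Function.Injective (rowString : _ → Cell N k → Bool) := by
  intro u v huv
  funext j
  have := congrFun huv (j, .u 0)
  simpa [rowString] using this

theorem ket_rowString (u : Fin (N + 1) → Bool) : ket (rowString u : Cell N k → Bool) = rowKet u :=
  ket_eq_regState (clear_rowString u)

/-- The state `f` of the row register, with zeroes elsewhere. -/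
def lift (f : State (Fin (N + 1))) : State (Cell N k) := ∑ u, f u • rowKet u

theorem lift_rowString (f : State (Fin (N + 1))) (u : Fin (N + 1) → Bool) :
    lift f (rowString u : Cell N k → Bool) = f u := by
  simp only [lift, ← ket_rowString, Finset.sum_apply, Pi.smul_apply, ket, smul_eq_mul, mul_ite,
    mul_one, mul_zero, rowString_injective.eq_iff]
  simp

theorem lift_eq_zero (f : State (Fin (N + 1))) {x : Cell N k → Bool} (hx : ∀ u, x ≠ rowString u) :
    lift f x = 0 := by
  simp only [lift, ← ket_rowString, Finset.sum_apply, Pi.smul_apply, ket, smul_eq_mul,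
    mul_zero, hx, if_false, Finset.sum_const_zero]

theorem lift_smul (c : ℂ) (f : State (Fin (N + 1))) :
    (lift (c • f) : State (Cell N k)) = c • lift f := by
  simp only [lift, Pi.smul_apply, smul_eq_mul, mul_smul, Finset.smul_sum]

theorem regState_eq_lift (μ : Fin (N + 1) → Bool → ℂ) :
    (regState (fun _ => bit false) μ fun _ => bit false : State (Cell N k)) =
      lift (productState μ) := by
  funext x
  by_cases hx : ∃ u, x = rowString u
  · obtain ⟨u, rfl⟩ := hx
    rw [lift_rowString, regState_apply _ _ _ (clear_rowString u)]
    simp [regS, regU, regV, rowString, bit, productState]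
  · push Not at hx
    rw [lift_eq_zero _ hx]
    by_contra hne
    have hc := clear_of_regState_ne_zero hne
    rw [regState_apply _ _ _ hc] at hne
    have hS := Finset.prod_ne_zero_iff.1 (left_ne_zero_of_mul hne)
    have hV := Finset.prod_ne_zero_iff.1 (right_ne_zero_of_mul (right_ne_zero_of_mul hne))
    apply hx (regU x)
    funext ⟨j, c⟩
    cases c with
    | st => exact eq_of_bit_ne_zero (hS j (Finset.mem_univ j))
    | u i =>
      by_cases hi : i = 0
      · subst hi
        rfl
      · simp [rowString, hi, hc.u j i hi]
    | l t => exact hc.l j t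
    | v t =>
      by_cases hj : j = 0
      · subst hj
        exact eq_of_bit_ne_zero (hV t (Finset.mem_univ t))
      · exact hc.v j t hj

theorem lift_ket (u : Fin (N + 1) → Bool) : (lift (ket u) : State (Cell N k)) = rowKet u := by
  rw [ket_eq_productState, ← regState_eq_lift, rowKet]

/-- Reduces a linear operation on the row register to its action on basis states; the common branch
factor permits the linear extension. -/
theorem implements_lift {l : ℕ} {F : State (Fin (N + 1)) → State (Fin (N + 1))}
    (hF : IsLinearMap ℂ F) (h : Implements Cell.Adj D l (fun u => (rowKet u : State (Cell N k)))
      (fun u => lift (F (ket u)))) {ι : Type*} (f : ι → State (Fin (N + 1))) :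
    Implements Cell.Adj D l (fun i => (lift (f i) : State (Cell N k))) (fun i => lift (F (f i))) := by
  have hs := h.sum fun i u => f i u
  have e : (fun i => ∑ u, f i u • (lift (F (ket u)) : State (Cell N k))) =
      fun i => lift (F (f i)) := by
    funext i
    have : F (f i) = ∑ u, f i u • F (ket u) := by
      conv_lhs => rw [state_eq_sum_ket (f i), ← hF.mk'_apply, map_sum]
      simp only [map_smul, IsLinearMap.mk'_apply]
    rw [this]
    simp only [lift, Finset.sum_apply, Finset.sum_smul, Finset.smul_sum, Pi.smul_apply,
      smul_eq_mul, mul_smul]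
    exact Finset.sum_comm
  rw [e] at hs
  exact hs

theorem implements_rotate {ι : Type*} (β : ℝ) (f : ι → State (Fin (N + 1))) :
    Implements Cell.Adj D 2 (fun i => (lift (f i) : State (Cell N k)))
      (fun i => lift (rotate β (f i))) := by
  refine implements_lift (isLinearMap_tensor _) ?_ f
  simp only [ket_eq_productState, tensor_productState, ← regState_eq_lift]
  exact implements_rowGates _ _ _ fun _ => rotation β

variable (hN : N ≤ 2 ^ h) (hk : k ≤ 2 ^ h) (hD : 3 * h ≤ D) (hkN : 2 ^ k ≤ 2 * (N + 1))
  (hNk : N + 1 < 2 ^ k)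
include hN hk hD hkN hNk

theorem implements_lift_weightSign {c : ℕ} (hc : c ≤ 1) {ι : Type*}
    (f : ι → State (Fin (N + 1))) :
    Implements Cell.Adj D 224 (fun i => (lift (f i) : State (Cell N k)))
      (fun i => lift fun u => weightSign c u * f i u) := by
  refine implements_lift (F := fun f u => weightSign c u * f u) ⟨?_, ?_⟩ ?_ f
  · intro f g
    funext u
    simp [mul_add]
  · intro a f
    funext u
    simp only [Pi.smul_apply, smul_eq_mul]
    ring
  · convert implements_weightSign hN hk hD hkN hNk hc using 2 with u
    rw [← lift_ket, ← lift_smul]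
    congr 1
    funext v
    simp only [ket, Pi.smul_apply, smul_eq_mul]
    split_ifs with hv
    · rw [hv]
    · simp

/-- The rounds add up as `2 + 224 + 2 + 224 + 2`: three rotations and two sign flips. -/
theorem implements_wState : Implements Cell.Adj D 454
    (fun _ : Unit => (zeroState : State (Cell N k))) (fun _ => lift (wState (N + 1))) := by
  obtain ⟨β, hβ⟩ := exists_rotation (n := N + 1) (by omega)
  obtain ⟨c, hc⟩ := amplify β (by omega) hβ
  have h₀ : (zeroState : State (Cell N k)) = lift (ket fun _ => false) := by
    rw [lift_ket, ← ket_rowString, zeroState]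
    congr 1
    funext ⟨j, c⟩
    cases c <;> simp [rowString]
  have h₁ := ((((implements_rotate (N := N) (k := k) (D := D) β
    fun _ : Unit => ket fun _ => false).trans
    (implements_lift_weightSign hN hk hD hkN hNk le_rfl _)).trans
    (implements_rotate (-β) _)).trans
    (implements_lift_weightSign hN hk hD hkN hNk zero_le_one _)).trans
    (implements_rotate β _)
  rw [h₀]
  refine h₁.of_eq_smul c fun _ => ?_
  rw [hc, lift_smul]

end Cell


/-! ## Renaming qubits -/

namespace Formula

variable {α β : Type}

/-- Rename the input wires. -/
def map (f : α → β) : Formula α → Formula β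
  | const b => const b
  | var a => var (f a)
  | not g => not (g.map f)
  | and g g' => and (g.map f) (g'.map f)
  | or g g' => or (g.map f) (g'.map f)

theorem eval_map (f : α → β) (m : β → Bool) (g : Formula α) :
    (g.map f).eval m = g.eval fun a => m (f a) := by
  induction g <;> simp_all [map, eval]

theorem depth_map (f : α → β) (g : Formula α) : (g.map f).depth = g.depth := by
  induction g <;> simp_all [map, depth]

theorem exists_of_mem_vars_map (f : α → β) (g : Formula α) {b : β} (hb : b ∈ (g.map f).vars) :
    ∃ a ∈ g.vars, f a = b := by
  induction g with
  | const c => exact hb.elim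
  | var a => exact ⟨a, rfl, hb.symm⟩
  | not g ih => exact ih hb
  | and g g' ih ih' =>
    rcases hb with hb | hb
    · obtain ⟨a, ha, h⟩ := ih hb
      exact ⟨a, Or.inl ha, h⟩
    · obtain ⟨a, ha, h⟩ := ih' hb
      exact ⟨a, Or.inr ha, h⟩
  | or g g' ih ih' =>
    rcases hb with hb | hb
    · obtain ⟨a, ha, h⟩ := ih hb
      exact ⟨a, Or.inl ha, h⟩
    · obtain ⟨a, ha, h⟩ := ih' hb
      exact ⟨a, Or.inr ha, h⟩

end Formula

section Rename

variable {Q Q' : Type} [DecidableEq Q] [DecidableEq Q'] (e : Q ≃ Q')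

/-- Rename the qubits of a gate. -/
def Gate.map : Gate Q → Gate Q'
  | .single q U => .single (e q) U
  | .cnot c t => .cnot (e c) (e t)

/-- Rename the qubits of a controlled gate. -/
def ControlledGate.map {w : ℕ} (g : ControlledGate Q w) : ControlledGate Q' w :=
  ⟨g.control, g.gate.map e⟩

/-- Rename the qubits of a round. -/
def Round.map (R : Round Q) : Round Q' where
  width := R.width
  classical i := (R.classical i).map fun v => (v.1, e v.2)
  quantum := R.quantum.map fun step => step.map fun g => g.map e
  measured := R.measured.map e.toEmbedding

/-- Rename the qubits of a circuit. -/
def Circuit.rename (C : Circuit Q) : Circuit Q' := List.map (Round.map e) C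

/-- Rename the qubits of a state. -/
def State.rename (ψ : State Q) : State Q' := fun x => ψ fun q => x (e q)

theorem Gate.support_map (g : Gate Q) : (g.map e).support = g.support.map e.toEmbedding := by
  cases g with
  | single q U => simp [Gate.map, Gate.support]
  | cnot c t =>
    ext q
    simp [Gate.map, Gate.support]

theorem update_comp_equiv (x : Q' → Bool) (q : Q) (b : Bool) :
    (fun p => Function.update x (e q) b (e p)) = Function.update (fun p => x (e p)) q b := by
  funext p
  by_cases h : p = q
  · subst h
    simp
  · rw [Function.update_of_ne h, Function.update_of_ne fun h' => h (e.injective h')]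

theorem Gate.apply_map (g : Gate Q) (ψ : State Q) :
    (g.map e).apply (ψ.rename e) = (g.apply ψ).rename e := by
  funext x
  cases g <;> simp only [Gate.map, Gate.apply, State.rename, update_comp_equiv]

theorem ControlledGate.apply_map {w : ℕ} (y : Fin w → Bool) (g : ControlledGate Q w)
    (ψ : State Q) : (g.map e).apply y (ψ.rename e) = (g.apply y ψ).rename e := by
  rcases g with ⟨_ | i, g⟩
  · exact g.apply_map e ψ
  · simp only [ControlledGate.map, ControlledGate.apply]
    by_cases h : y i = true
    · simp only [h, if_true, g.apply_map e ψ]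
    · simp only [h, Bool.false_eq_true, if_false]

theorem foldl_map_rename {α : Type} (F : α → State Q → State Q) (F' : α → State Q' → State Q')
    (h : ∀ a ψ, F' a (ψ.rename e) = (F a ψ).rename e) (l : List α) (ψ : State Q) :
    l.foldl (fun ψ a => F' a ψ) (ψ.rename e) = (l.foldl (fun ψ a => F a ψ) ψ).rename e := by
  induction l generalizing ψ with
  | nil => rfl
  | cons a l ih => rw [List.foldl_cons, h, ih, List.foldl_cons]

theorem Round.applyQuantum_map (R : Round Q) (y : Fin R.width → Bool) (ψ : State Q) :
    (R.map e).applyQuantum y (ψ.rename e) = (R.applyQuantum y ψ).rename e := by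
  simp only [Round.applyQuantum, Round.map, List.foldl_map]
  refine foldl_map_rename e
    (fun (step : List (ControlledGate Q R.width)) ψ => step.foldl (fun ψ g => g.apply y ψ) ψ)
    (fun (step : List (ControlledGate Q R.width)) ψ =>
      step.foldl (fun ψ g => (g.map e).apply y ψ) ψ) (fun step ψ => ?_) R.quantum ψ
  exact foldl_map_rename e (fun (g : ControlledGate Q R.width) ψ => g.apply y ψ)
    (fun g ψ => (g.map e).apply y ψ) (fun g ψ => g.apply_map e y ψ) step ψ

theorem project_map (M : Finset Q) (b : Q' → Bool) (ψ : State Q) :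
    project (M.map e.toEmbedding) b (ψ.rename e) =
      (project M (fun q => b (e q)) ψ).rename e := by
  funext x
  simp only [project, State.rename, Finset.forall_mem_map, Equiv.coe_toEmbedding]

theorem runFrom_rename (m : ℕ × Q' → Bool) (t : ℕ) (C : Circuit Q) (ψ : State Q) :
    runFrom m t (C.rename e) (ψ.rename e) =
      (runFrom (fun v => m (v.1, e v.2)) t C ψ).rename e := by
  induction C generalizing t ψ with
  | nil => rfl
  | cons R C ih =>
    have h : (fun i => ((R.map e).classical i).eval m) =
        fun i => (R.classical i).eval fun v => m (v.1, e v.2) := by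
      funext i
      exact Formula.eval_map _ _ _
    simp only [Circuit.rename, List.map_cons, runFrom] at ih ⊢
    rw [← ih]
    congr 1
    rw [h, Round.applyQuantum_map]
    exact project_map e _ _ _

theorem Circuit.WellFormed.rename [Fintype Q] [Fintype Q'] {adj : Q → Q → Prop}
    {adj' : Q' → Q' → Prop} (hadj : ∀ p q, adj p q → adj' (e p) (e q)) {D t : ℕ} {C : Circuit Q}
    (h : C.WellFormed adj D t) : Circuit.WellFormed adj' D t (C.rename e) where
  parallel R' hR' step' hs' := by
    obtain ⟨R, hR, rfl⟩ := List.mem_map.1 hR'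
    obtain ⟨step, hs, rfl⟩ := List.mem_map.1 hs'
    refine List.pairwise_map.2 ((h.parallel R hR step hs).imp ?_)
    intro g g' hgg
    simpa only [ControlledGate.map, Gate.support_map, Finset.disjoint_map] using hgg
  causal i R' hR' j v hv := by
    simp only [Circuit.rename, List.getElem?_map, Option.map_eq_some_iff] at hR' ⊢
    obtain ⟨R, hR, rfl⟩ := hR'
    obtain ⟨w, hw, rfl⟩ := Formula.exists_of_mem_vars_map _ _ hv
    obtain ⟨s, R', hs, hR', h₁, h₂⟩ := h.causal i R hR j w hw
    exact ⟨s, R'.map e, hs, ⟨R', hR', rfl⟩, h₁, Finset.mem_map_of_mem _ h₂⟩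
  nearest R' hR' step' hs' g' hg' c t hct := by
    obtain ⟨R, hR, rfl⟩ := List.mem_map.1 hR'
    obtain ⟨step, hs, rfl⟩ := List.mem_map.1 hs'
    obtain ⟨⟨x, g⟩, hg, rfl⟩ := List.mem_map.1 hg'
    cases g with
    | single q U => simp [ControlledGate.map, Gate.map] at hct
    | cnot c₀ t₀ =>
      simp only [ControlledGate.map, Gate.map, Gate.cnot.injEq] at hct
      obtain ⟨rfl, rfl⟩ := hct
      exact hadj _ _ (h.nearest R hR step hs _ hg c₀ t₀ rfl)
  classicalDepth R' hR' i := by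
    obtain ⟨R, hR, rfl⟩ := List.mem_map.1 hR'
    exact (Formula.depth_map _ _).trans_le (h.classicalDepth R hR i)
  quantumDepth R' hR' := by
    obtain ⟨R, hR, rfl⟩ := List.mem_map.1 hR'
    exact (List.length_map _).trans_le (h.quantumDepth R hR)
  width_le R' hR' := by
    obtain ⟨R, hR, rfl⟩ := List.mem_map.1 hR'
    rw [← Fintype.card_congr e]
    exact h.width_le R hR
  gates_le R' hR' := by
    obtain ⟨R, hR, rfl⟩ := List.mem_map.1 hR'
    rw [← Fintype.card_congr e]
    convert h.gates_le R hR using 2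
    simp [Round.map, Function.comp_def]

end Rename

/-! ## Bounds on the size of a circuit -/

section Bounds

variable {Q : Type} [Fintype Q] [DecidableEq Q] {adj : Q → Q → Prop} {D t : ℕ} {C : Circuit Q}

theorem Circuit.WellFormed.quantumSize_le (h : C.WellFormed adj D t) :
    C.quantumSize ≤ C.length * Fintype.card Q := by
  have := List.sum_le_card_nsmul (C.map fun R => (R.quantum.map List.length).sum)
    (Fintype.card Q) fun x hx => by
      obtain ⟨R, hR, rfl⟩ := List.mem_map.1 hx
      exact h.gates_le R hR
  simpa [Circuit.quantumSize] using this

theorem Circuit.WellFormed.classicalSize_le (h : C.WellFormed adj D t) :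
    C.classicalSize ≤ C.length * (Fintype.card Q * 2 ^ (D + 1)) := by
  have := List.sum_le_card_nsmul (C.map fun R => ∑ i, (R.classical i).size)
    (Fintype.card Q * 2 ^ (D + 1)) fun x hx => by
      obtain ⟨R, hR, rfl⟩ := List.mem_map.1 hx
      calc ∑ i, (R.classical i).size ≤ ∑ i : Fin R.width, 2 ^ (D + 1) :=
            Finset.sum_le_sum fun i _ => (R.classical i).size_lt.le.trans
              (Nat.pow_le_pow_right (by norm_num)
                (Nat.add_le_add_right (h.classicalDepth R hR i) 1))
        _ = R.width * 2 ^ (D + 1) := by simp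
        _ ≤ _ := Nat.mul_le_mul_right _ (h.width_le R hR)
  simpa [Circuit.classicalSize] using this

theorem Circuit.WellFormed.causal' (h : C.WellFormed adj D 0) : C.Causal := by
  intro t i v hv
  obtain ⟨s, R, hs, hR, h₁, h₂⟩ := h.causal t (C.get t) (by simp) i v hv
  obtain ⟨hlen, rfl⟩ := List.getElem?_eq_some_iff.1 hR
  exact ⟨⟨s, hlen⟩, hs, by simpa using h₁, h₂⟩

end Bounds

/-! ## The circuit on the grid -/

theorem isNormalized_wState {n : ℕ} (hn : 1 ≤ n) : IsNormalized (wState n) := by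
  have hn' : (0 : ℝ) < n := by exact_mod_cast hn
  rw [IsNormalized, ← Fintype.sum_of_injective (oneHot : Fin n → _) oneHot_injective
    (fun _ => 1 / (n : ℝ))]
  · simp only [Finset.sum_const, Finset.card_univ, Fintype.card_fin, nsmul_eq_mul]
    field_simp
  · intro x hx
    have : ∀ i, x ≠ oneHot i := fun i h => hx ⟨i, h.symm⟩
    simp [wState, ket, this]
  · intro i
    simp only [wState, ket, oneHot_injective.eq_iff]
    simp only [Finset.sum_ite_eq, Finset.mem_univ, if_true, mul_one, norm_div, norm_one,
      Complex.norm_real, Real.norm_eq_abs, abs_of_nonneg (Real.sqrt_nonneg _), div_pow, one_pow,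
      Real.sq_sqrt hn'.le]

namespace Cell

variable {N k : ℕ}

/-- The output register on the grid. -/
noncomputable def output (N k : ℕ) : Fin (N + 1) ↪ Grid (N + 1) (3 * k + 2) where
  toFun j := cellEquiv N k (j, .u 0)
  inj' _ _ h := congrArg Prod.fst ((cellEquiv N k).injective h)

theorem rename_lift (f : State (Fin (N + 1))) :
    (lift f : State (Cell N k)).rename (cellEquiv N k) = withZeroAncillas (output N k) f := by
  funext x
  simp only [State.rename, withZeroAncillas]
  have hmem : ∀ q : Cell N k, cellEquiv N k q ∈ Set.range (output N k) ↔ ∃ j, q = (j, .u 0) := by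
    intro q
    refine exists_congr fun j => ?_
    exact ⟨fun h => ((cellEquiv N k).injective h).symm, fun h => by rw [h]; rfl⟩
  split_ifs with hx
  · have : (fun q => x (cellEquiv N k q)) = rowString fun j => x (output N k j) := by
      funext ⟨j, c⟩
      cases c with
      | u i =>
        by_cases hi : i = 0
        · subst hi
          rfl
        · simp only [rowString, hi, if_false]
          exact hx _ (by rw [hmem]; simp [hi])
      | st => exact hx _ (by rw [hmem]; simp)
      | l t => exact hx _ (by rw [hmem]; simp)
      | v t => exact hx _ (by rw [hmem]; simp)
    rw [this, lift_rowString]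
  · refine lift_eq_zero _ fun u hu => hx fun q hq => ?_
    obtain ⟨⟨j, c⟩, rfl⟩ := (cellEquiv N k).surjective q
    rw [hmem] at hq
    rw [congrFun hu (j, c)]
    cases c with
    | u i =>
      by_cases hi : i = 0
      · subst hi
        exact absurd ⟨j, rfl⟩ hq
      · simp [rowString, hi]
    | st => rfl
    | l t => rfl
    | v t => rfl

theorem isNormalized_withZeroAncillas {f : State (Fin (N + 1))} (hf : IsNormalized f) :
    IsNormalized (withZeroAncillas (output N k) f) := by
  rw [← rename_lift, IsNormalized]
  have h := ((cellEquiv N k).arrowCongr (Equiv.refl Bool)).sum_comp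
    fun x => ‖(lift f : State (Cell N k)).rename (cellEquiv N k) x‖ ^ 2
  rw [← h, ← hf]
  symm
  refine Fintype.sum_of_injective (rowString : _ → Cell N k → Bool) rowString_injective _ _ ?_ ?_
  · intro x hx
    have : lift f x = 0 := lift_eq_zero f fun u hu => hx ⟨u, hu.symm⟩
    simp [State.rename, Equiv.arrowCongr, this]
  · intro u
    simp [State.rename, Equiv.arrowCongr, lift_rowString]

/-- Row lines have `k` links and column lines `N`, both at most `2 ^ k`. Parity trees of height `k`
therefore suffice, whence the classical depth `3 * k`. -/
theorem exists_circuit (hk : 2 ^ k ≤ 2 * (N + 1)) (hk' : N + 1 < 2 ^ k) :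
    ∃ C : Circuit (Grid (N + 1) (3 * k + 2)), C.length ≤ 454 ∧
      C.WellFormed Grid.Adj (3 * k) 0 ∧
      Prepares C (withZeroAncillas (output N k) (wState (N + 1))) := by
  obtain ⟨C, hl, hw, hr⟩ := implements_wState (N := N) (k := k) (h := k) (by omega)
    Nat.lt_two_pow_self.le le_rfl hk hk' 0
  refine ⟨C.rename (cellEquiv N k), (List.length_map _).trans_le hl,
    hw.rename (cellEquiv N k) fun _ _ h => h,
    isNormalized_withZeroAncillas (isNormalized_wState (by omega)), fun m => ?_⟩
  obtain ⟨c, hc⟩ := hr fun v => m (v.1, cellEquiv N k v.2)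
  refine ⟨c, ?_⟩
  have hz : (zeroState : State (Grid (N + 1) (3 * k + 2))) =
      (zeroState : State (Cell N k)).rename (cellEquiv N k) := by
    funext x
    simp only [zeroState, ket, State.rename, funext_iff, (cellEquiv N k).forall_congr_left]
    simp
  rw [hz, runFrom_rename, hc (), ← rename_lift]
  rfl

end Cell

/-- The number of columns of the grid. -/
def numColumns (n : ℕ) : ℕ := 3 * (Nat.log 2 n + 1) + 2

theorem exists_wState_circuit (n : ℕ) :
    ∃ (C : Circuit (Grid n (numColumns n))) (out : Fin n ↪ Grid n (numColumns n)),
      C.length ≤ 454 ∧ C.WellFormed Grid.Adj (3 * (Nat.log 2 n + 1)) 0 ∧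
      (∃ φ, Prepares C φ) ∧ (1 ≤ n → Prepares C (withZeroAncillas out (wState n))) := by
  cases n with
  | zero =>
    -- For `n = 0` there are no qubits, and the empty circuit prepares the only basis state.
    refine ⟨[], ⟨fun i => i.elim0, fun i => i.elim0⟩, by simp, ?_, ⟨zeroState, ?_, fun m => ⟨1, ?_⟩⟩,
      by simp⟩
    · constructor <;> simp [Circuit.Parallel, Circuit.Local, Circuit.ClassicalDepthLE,
        Circuit.QuantumDepthLE]
    · simp [IsNormalized, zeroState, ket, Unique.eq_default]
    · rw [one_smul]
      rfl
  | succ N =>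
    have h₁ : 2 ^ Nat.log 2 (N + 1) ≤ N + 1 := Nat.pow_log_le_self 2 (by omega)
    have h₂ : N + 1 < 2 ^ (Nat.log 2 (N + 1) + 1) := Nat.lt_pow_succ_log_self (by norm_num) _
    -- The bit length of `n` is the `k` satisfying both `2 ^ k ≤ 2 * n` and `n < 2 ^ k`.
    obtain ⟨C, hl, hw, hp⟩ := Cell.exists_circuit (N := N) (k := Nat.log 2 (N + 1) + 1)
      (by rw [pow_succ]; omega) h₂
    exact ⟨C, Cell.output N _, hl, hw, ⟨_, hp⟩, fun _ => hp⟩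

theorem natLog_isBigO : (fun n : ℕ => ((Nat.log 2 n + 1 : ℕ) : ℝ)) =O[atTop]
    fun n : ℕ => Real.log n := by
  refine IsBigO.of_bound 3 ?_
  -- From `n = 3` on, `log n ≥ 1` absorbs the additive constant.
  filter_upwards [eventually_ge_atTop 3] with n hn
  have hn' : (3 : ℝ) ≤ n := by exact_mod_cast hn
  have h1 : 1 ≤ Real.log n := by
    rw [Real.le_log_iff_exp_le (by linarith)]
    linarith [Real.exp_one_lt_d9]
  have h2 : (Nat.log 2 n : ℝ) * Real.log 2 ≤ Real.log n := by
    rw [← Real.log_pow]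
    refine Real.log_le_log (by positivity) ?_
    exact_mod_cast Nat.pow_log_le_self 2 (by omega)
  have h3 : (0 : ℝ) ≤ (Nat.log 2 n : ℝ) := Nat.cast_nonneg _
  rw [Real.norm_of_nonneg (Nat.cast_nonneg _), Real.norm_of_nonneg (by linarith)]
  push_cast
  nlinarith [Real.log_two_gt_d9]

theorem numColumns_isBigO : (fun n : ℕ => (numColumns n : ℝ)) =O[atTop]
    fun n : ℕ => Real.log n := by
  refine IsBigO.trans (IsBigO.of_bound 5 (Eventually.of_forall fun n => ?_)) natLog_isBigO
  rw [Real.norm_of_nonneg (Nat.cast_nonneg _), Real.norm_of_nonneg (Nat.cast_nonneg _)]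
  have : numColumns n ≤ 5 * (Nat.log 2 n + 1) := by
    rw [numColumns]
    omega
  exact_mod_cast this

theorem card_grid_le {n : ℕ} (hn : 1 ≤ n) : Fintype.card (Grid n (numColumns n)) ≤ 8 * n ^ 2 := by
  have h : numColumns n ≤ 8 * n := by
    have := Nat.log_le_self 2 n
    rw [numColumns]
    omega
  rw [Fintype.card_prod, Fintype.card_fin, Fintype.card_fin]
  nlinarith

theorem isBigO_of_le {f : ℕ → ℕ} {c k : ℕ} (h : ∀ n, 1 ≤ n → f n ≤ c * n ^ k) :
    (fun n => (f n : ℝ)) =O[atTop] fun n : ℕ => (n : ℝ) ^ k := by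
  refine IsBigO.of_bound c ?_
  filter_upwards [eventually_ge_atTop 1] with n hn
  rw [Real.norm_of_nonneg (Nat.cast_nonneg _), Real.norm_of_nonneg (by positivity)]
  exact_mod_cast h n hn

end LAQCC

theorem mainTheorem2 :
    ∃ (cols : ℕ → ℕ) (C : ∀ n : ℕ, LAQCC.Circuit (LAQCC.Grid n (cols n)))
      (out : ∀ n : ℕ, Fin n ↪ LAQCC.Grid n (cols n)),
      LAQCC.IsLAQCC C ∧
      (∀ n : ℕ, 1 ≤ n →
        LAQCC.Prepares (C n) (LAQCC.withZeroAncillas (out n) (LAQCC.wState n))) ∧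
      ((fun n : ℕ => (cols n : ℝ)) =O[atTop] fun n : ℕ => Real.log n) ∧
      ((fun n : ℕ => (Fintype.card (LAQCC.Grid n (cols n)) : ℝ)) =O[atTop]
        fun n : ℕ => (n : ℝ) * Real.log n) := by
  choose C out hlen hwf hdet hprep using LAQCC.exists_wState_circuit
  refine ⟨LAQCC.numColumns, C, out, ?_, hprep, LAQCC.numColumns_isBigO, ?_⟩
  · refine ⟨fun n => (hwf n).parallel, fun n => (hwf n).causal', fun n => (hwf n).nearest,
      ⟨454, hlen⟩, ⟨1, fun n => (hwf n).quantumDepth⟩, ⟨2, ?_⟩,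
      ⟨fun n => 3 * (Nat.log 2 n + 1), fun n => (hwf n).classicalDepth, ?_⟩, ⟨5, ?_⟩, hdet⟩
    · refine LAQCC.isBigO_of_le (c := 454 * 8) fun n hn => ?_
      calc (C n).quantumSize ≤ (C n).length * Fintype.card (LAQCC.Grid n (LAQCC.numColumns n)) :=
            (hwf n).quantumSize_le
        _ ≤ 454 * (8 * n ^ 2) := Nat.mul_le_mul (hlen n) (LAQCC.card_grid_le hn)
        _ = 454 * 8 * n ^ 2 := by ring
    · have := LAQCC.natLog_isBigO.const_mul_left 3
      simpa using this
    · refine LAQCC.isBigO_of_le (c := 454 * 8 * 16) fun n hn => ?_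
      -- A tree of the permitted depth has cubic size; with at most `8 * n ^ 2` outputs per round
      -- this gives the exponent five.
      have hpow : 2 ^ (3 * (Nat.log 2 n + 1) + 1) ≤ 16 * n ^ 3 := by
        calc 2 ^ (3 * (Nat.log 2 n + 1) + 1) = 16 * (2 ^ Nat.log 2 n) ^ 3 := by ring
          _ ≤ 16 * n ^ 3 := Nat.mul_le_mul_left _
            (Nat.pow_le_pow_left (Nat.pow_log_le_self 2 (by omega)) 3)
      calc (C n).classicalSize
          ≤ (C n).length * (Fintype.card (LAQCC.Grid n (LAQCC.numColumns n)) *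
              2 ^ (3 * (Nat.log 2 n + 1) + 1)) := (hwf n).classicalSize_le
        _ ≤ 454 * (8 * n ^ 2 * (16 * n ^ 3)) :=
            Nat.mul_le_mul (hlen n) (Nat.mul_le_mul (LAQCC.card_grid_le hn) hpow)
        _ = 454 * 8 * 16 * n ^ 5 := by ring
  · have h := (isBigO_refl (fun n : ℕ => (n : ℝ)) atTop).mul LAQCC.numColumns_isBigO
    simpa using h
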